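/- **Theorem.** Let $G$ be a countable amenable group acting by measure-preserving transformations on a standard Borel probability space $(X,\mu)$ without atoms, and let $\lambda=\{F_n\}$ be a left Følner sequence of non-empty finite subsets of $G$, i.e. $|gF_n\triangle F_n|/|F_n|\to 0$ for every $g\in G$. *Notation.* A measurable semimetric is a symmetric function $\rho\colon X^2\to[0,\infty)$, measurable with respect to (the completion of) $\mu^2$, that vanishes on the diagonal and satisfies the triangle inequality. It is *admissible* if it is separable on some set of full measure, *summable* if $\rho\in L^1(X^2,\mu^2)$, and *generating* if there is a set $X_0$ of full measure such that for any distinct $x,y\in X_0$ some $g\in\bigcup_n F_n$ has $\rho(gx,gy)>0$. Put $G^n_{av}\rho(x,y)=\frac1{|F_n|}\sum_{g\in F_n}\rho(gx,gy)$. The $\varepsilon$-entropy $\mathbb H_\varepsilon(X,\mu,\rho)$ is $\log_2 k$ for the least positive integer $k$ such that $X$ is a union of measurable sets $X_0,\dots,X_k$ with $\mu(X_0)<\varepsilon$ and $\operatorname{diam}_\rho(X_i)<\varepsilon$ for $1\le i\le k$ (and $+\infty$ if there is no such $k$); put $\Phi_\rho(n,\varepsilon)=\mathbb H_\varepsilon(X,\mu,G^n_{av}\rho)$.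 For non-negative sequences, $\phi\lesssim\psi$ means that $\phi(n)\le C\psi(n)$ for all $n$ with some constant $C>0$, and $\phi\asymp\psi$ means $\phi\lesssim\psi\lesssim\phi$. For non-negative functions of $n\in\mathbb N$ and $\varepsilon>0$, $\Psi\preceq\Phi$ means that for every $\varepsilon>0$ there is $\delta>0$ with $\Psi(\cdot,\varepsilon)\lesssim\Phi(\cdot,\delta)$. Let $\mathcal H(X,\mu,G,\lambda)$ be the set of all $\Phi$ such that $\Phi\preceq\Phi_\rho\preceq\Phi$ for some admissible generating summable semimetric $\rho$. The system is *stable* if there is a non-negative sequence $\{h_n\}$ such that for every admissible generating summable semimetric $\rho$ and all sufficiently small $\varepsilon>0$ one has $\Phi_\rho(n,\varepsilon)\asymp h_n$. The amenable measure entropy is $h(X,\mu,G)=\sup_\xi h(\xi)$ with $h(\xi)=\lim_{n}\frac1{|F_n|}H\bigl(\bigvee_{g\in F_n}g^{-1}\xi\bigr)$, where $\xi$ runs over the countable measurable partitions of finite Shannon entropy $H(\xi)=-\int_X\log\mu(\xi(x))\,d\mu(x)$ and $\xi(x)$ is the cell of $\xi$ that contains $x$. (The limit always exists.) *Claim.*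 1. If $h(X,\mu,G)>0$, then the system is stable, and for every $\Phi\in\mathcal H(X,\mu,G,\lambda)$ that is non-increasing in $\varepsilon$ (for each $n$), one has $\Phi(n,\varepsilon)\asymp|F_n|$ for all sufficiently small $\varepsilon>0$ (the constants may depend on $\varepsilon$). 2. If $h(X,\mu,G)=0$, then for every $\Phi\in\mathcal H(X,\mu,G,\lambda)$ and every $\varepsilon>0$, $\Phi(n,\varepsilon)=o(|F_n|)$ as $n\to\infty$. -/

import Mathlib

open MeasureTheory Filter Set Topology
open scoped ENNReal NNReal

noncomputable section

namespace ScalingEntropy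

/-! ### Følner equipment -/

/-- A sequence of non-empty finite subsets of `G` which is left Følner:
`|g F_n ∆ F_n| / |F_n| → 0` for all `g`. It is Mathlib's notion, for the action of `G` on itself by
left multiplication and the counting measure on all subsets of `G`. -/
def IsLeftFolner {G : Type*} [Group G] (F : ℕ → Finset G) : Prop :=
  (∀ n, (F n).Nonempty) ∧
    let _ : MeasurableSpace G := ⊤
    IsFoelner G (Measure.count : Measure G) atTop (fun n => (F n : Set G))

/-! ### Amenable measure entropy -/

/-- The Shannon entropy `H(ξ) = -∫ log μ(ξ(x)) dμ(x)` of the countable partition of `X` into the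
fibres of `ξ : X → α`, where `ξ(x)` is the fibre that contains `x`. -/
def shannonEntropy {X α : Type*} [MeasurableSpace X] [Countable α] (μ : Measure X) (ξ : X → α) :
    ℝ≥0∞ :=
  ∫⁻ x, ENNReal.ofReal (-Real.log (μ.real (ξ ⁻¹' {ξ x}))) ∂μ

/-- The refinement `⋁_{g ∈ S} g⁻¹ξ`: two points lie in the same cell if and only if
`ξ (g x) = ξ (g y)` for all `g ∈ S`. -/
def refine {G X α : Type*} [Group G] [MulAction G X] (S : Finset G) (ξ : X → α) :
    X → (S → α) :=
  fun x g => ξ ((g : G) • x)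

/-- The entropy `h(ξ)` of a partition with respect to the action. For a left Følner sequence and a
partition of finite entropy, the upper limit is a limit. -/
def partitionEntropy {G X : Type*} [Group G] [MulAction G X] [MeasurableSpace X]
    (μ : Measure X) (F : ℕ → Finset G) (ξ : X → ℕ) : ℝ≥0∞ :=
  limsup (fun n => shannonEntropy μ (refine (F n) ξ) / ((F n).card : ℝ≥0∞)) atTop

/-- The amenable measure entropy `h(X, μ, G)`: the supremum of `h(ξ)` over the measurable
partitions `ξ` of finite entropy. Such a partition is countable up to a null set, so it is
given by a measurable map to `ℕ`. -/
def measureEntropy {G X : Type*} [Group G] [MulAction G X] [MeasurableSpace X]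
    (μ : Measure X) (F : ℕ → Finset G) : ℝ≥0∞ :=
  ⨆ (ξ : X → ℕ) (_ : Measurable ξ) (_ : shannonEntropy μ ξ < ∞), partitionEntropy μ F ξ

/-! ### Semimetrics and their `ε`-entropy -/

/-- Measurable semimetrics on `(X, μ)`; measurability is with respect to the completed product
measure. -/
structure IsMeasurableSemimetric {X : Type*} [MeasurableSpace X] (μ : Measure X)
    (ρ : X → X → ℝ) : Prop where
  nonneg : ∀ x y, 0 ≤ ρ x y
  self : ∀ x, ρ x x = 0
  symm : ∀ x y, ρ x y = ρ y x
  triangle : ∀ x y z, ρ x z ≤ ρ x y + ρ y z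
  aemeasurable : AEMeasurable (fun p : X × X => ρ p.1 p.2) (μ.prod μ)

/-- A semimetric is admissible if it is separable on some set of full measure. -/
def IsAdmissible {X : Type*} [MeasurableSpace X] (μ : Measure X) (ρ : X → X → ℝ) : Prop :=
  ∃ X₀ ∈ ae μ, ∃ D ⊆ X₀, D.Countable ∧ ∀ x ∈ X₀, ∀ r > 0, ∃ d ∈ D, ρ x d < r

/-- A semimetric is generating if its shifts by the elements of `⋃ n, F n` together separate the
points of some set of full measure. -/
def IsGenerating {G X : Type*} [Group G] [MulAction G X] [MeasurableSpace X]
    (μ : Measure X) (F : ℕ → Finset G) (ρ : X → X → ℝ) : Prop :=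
  ∃ X₀ ∈ ae μ, ∀ x ∈ X₀, ∀ y ∈ X₀, x ≠ y → ∃ n, ∃ g ∈ F n, 0 < ρ (g • x) (g • y)

/-- Admissible generating summable semimetrics. -/
structure IsSuitableSemimetric {G X : Type*} [Group G] [MulAction G X] [MeasurableSpace X]
    (μ : Measure X) (F : ℕ → Finset G) (ρ : X → X → ℝ) : Prop where
  semimetric : IsMeasurableSemimetric μ ρ
  admissible : IsAdmissible μ ρ
  generating : IsGenerating μ F ρ
  summable : Integrable (fun p : X × X => ρ p.1 p.2) (μ.prod μ)

/-- The diameter of a set with respect to a semimetric. -/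
def diam {X : Type*} (ρ : X → X → ℝ) (A : Set X) : ℝ≥0∞ :=
  ⨆ (x ∈ A) (y ∈ A), ENNReal.ofReal (ρ x y)

/-- `X` is a union of measurable sets `X₀, X₁, …, X_k` such that `μ X₀ < ε` and `X₁, …, X_k` have
diameters less than `ε`. -/
def HasEpsCover {X : Type*} [MeasurableSpace X] (μ : Measure X) (ρ : X → X → ℝ) (ε : ℝ)
    (k : ℕ) : Prop :=
  ∃ (X₀ : Set X) (A : Fin k → Set X), MeasurableSet X₀ ∧ (∀ i, MeasurableSet (A i)) ∧
    X₀ ∪ ⋃ i, A i = univ ∧ μ X₀ < ENNReal.ofReal ε ∧ ∀ i, diam ρ (A i) < ENNReal.ofReal ε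

/-- The `ε`-entropy: `log₂ k` for the least positive `k` that admits a cover as above, and `∞` if
there is none. -/
def epsEntropy {X : Type*} [MeasurableSpace X] (μ : Measure X) (ρ : X → X → ℝ) (ε : ℝ) : ℝ≥0∞ :=
  ⨅ (k : ℕ) (_ : 1 ≤ k) (_ : HasEpsCover μ ρ ε k), ENNReal.ofReal (Real.logb 2 k)

/-- The average of the shifts of `ρ` by the elements of `S`. -/
def average {G X : Type*} [Group G] [MulAction G X] (S : Finset G) (ρ : X → X → ℝ) :
    X → X → ℝ :=
  fun x y => (S.card : ℝ)⁻¹ * ∑ g ∈ S, ρ (g • x) (g • y)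

/-- `Φ_ρ(n, ε)`, the `ε`-entropy of the average of `ρ` over `F n`. -/
def scalingFunction {G X : Type*} [Group G] [MulAction G X] [MeasurableSpace X]
    (μ : Measure X) (F : ℕ → Finset G) (ρ : X → X → ℝ) : ℕ → ℝ → ℝ≥0∞ :=
  fun n ε => epsEntropy μ (average (F n) ρ) ε

/-! ### Asymptotic relations and the scaling entropy class -/

/-- `φ ≲ ψ`: there is a positive constant `C` with `φ n ≤ C ψ n` for all `n`. -/
def AsympLE (φ ψ : ℕ → ℝ≥0∞) : Prop :=
  ∃ C : ℝ≥0, 0 < C ∧ ∀ n, φ n ≤ C * ψ n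

/-- `φ ≍ ψ`: there are positive constants `c`, `C` with `c φ n ≤ ψ n ≤ C φ n` for all `n`. -/
def AsympEq (φ ψ : ℕ → ℝ≥0∞) : Prop :=
  ∃ c C : ℝ≥0, 0 < c ∧ 0 < C ∧ ∀ n, c * φ n ≤ ψ n ∧ ψ n ≤ C * φ n

/-- `Ψ ⪯ Φ`: for every `ε > 0` there is `δ > 0` with `Ψ(n, ε) ≲ Φ(n, δ)`. Only positive values of
the second argument matter. -/
def ScalingLE (Ψ Φ : ℕ → ℝ → ℝ≥0∞) : Prop :=
  ∀ ε > 0, ∃ δ > 0, AsympLE (fun n => Ψ n ε) (fun n => Φ n δ)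

/-- The scaling entropy `𝓗(X, μ, G, F)`: all functions equivalent to `Φ_ρ` for some admissible
generating summable semimetric `ρ`. -/
def scalingEntropy {G X : Type*} [Group G] [MulAction G X] [MeasurableSpace X]
    (μ : Measure X) (F : ℕ → Finset G) : Set (ℕ → ℝ → ℝ≥0∞) :=
  {Φ | ∃ ρ : X → X → ℝ, IsSuitableSemimetric μ F ρ ∧
    ScalingLE Φ (scalingFunction μ F ρ) ∧ ScalingLE (scalingFunction μ F ρ) Φ}

/-- `h` is a scaling entropy sequence of the action and of the semimetric `ρ`: for all sufficiently
small `ε > 0`, `Φ_ρ(n, ε) ≍ h n`. -/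
def IsScalingSequenceFor {G X : Type*} [Group G] [MulAction G X] [MeasurableSpace X]
    (μ : Measure X) (F : ℕ → Finset G) (ρ : X → X → ℝ) (h : ℕ → ℝ≥0) : Prop :=
  ∃ ε₀ > 0, ∀ ε, 0 < ε → ε < ε₀ →
    AsympEq (fun n => scalingFunction μ F ρ n ε) (fun n => (h n : ℝ≥0∞))

/-- The scaling entropy sequences of the system: those that are scaling entropy sequences for every
admissible generating summable semimetric. -/
def scalingSequences {G X : Type*} [Group G] [MulAction G X] [MeasurableSpace X]
    (μ : Measure X) (F : ℕ → Finset G) : Set (ℕ → ℝ≥0) :=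
  {h | ∀ ρ : X → X → ℝ, IsSuitableSemimetric μ F ρ → IsScalingSequenceFor μ F ρ h}

/-- A system is stable if it has a scaling entropy sequence. -/
def IsStable {G X : Type*} [Group G] [MulAction G X] [MeasurableSpace X]
    (μ : Measure X) (F : ℕ → Finset G) : Prop :=
  (scalingSequences μ F).Nonempty

end ScalingEntropy

end

/-! Everything compares the averaged semimetric on `F n` with the names of points over `F n`, i.e.
with `refine (F n) η` for a finite partition `η`.

Upper bounds. Admissibility and summability give a finite `η` whose cells are `ρ`-small up to an
error of small integral (`exists_small_partition`). By Markov's inequality and invariance, off a set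
of small measure equal names over `S` force a small averaged distance, with the same `η` for every
`S` (`exists_names_partition`). Counting all names bounds the `ε`-entropy by a multiple of `|S|`. In
zero entropy, the names that are not exponentially rare number only `exp(o(|F n|))`, which gives
sublinear growth.

Lower bound. In positive entropy, truncating a countable partition gives a finite one whose entropy
grows at a positive rate along the Følner sequence. Strong subadditivity makes the entropy of names
a submodular function of the set of group elements, and a double count over translates turns this
into a linear bound `c * K.card` for all finite `K`. Since `ρ` is generating, the sets whose two
sides are separated by finitely many shifts of `ρ`, off a small set, form a `σ`-algebra that
contains every measurable set (Lusin–Souslin). Hence points that are close in the averaged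
semimetric have names close in Hamming distance, the Følner property absorbing the shifts. An
`ε`-cover with `k` cells then puts most names in `k` small Hamming balls. Coding names by these
balls bounds their entropy by `log k` plus a small multiple of `|F n|`, so `log k` is at least
linear in `|F n|`. The finitely many `n` not reached by this asymptotic argument are handled through
the absence of atoms: for small `ε` one cell never suffices. -/

namespace ScalingEntropy

set_option linter.unusedSectionVars false

/-! ### Shannon entropy -/

section Entropy

variable {X α β γ : Type*} [MeasurableSpace X] {μ : Measure X}

/-- The information function `-log μ(f⁻¹(f x))` of the partition into the fibres of `f`. -/
noncomputable def info (μ : Measure X) (f : X → α) (x : X) : ℝ :=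
  -Real.log (μ.real (f ⁻¹' {f x}))

/-- The Shannon entropy as a real number. -/
noncomputable def entropy (μ : Measure X) (f : X → α) : ℝ :=
  ∫ x, info μ f x ∂μ

theorem info_nonneg [IsProbabilityMeasure μ] (f : X → α) (x : X) : 0 ≤ info μ f x :=
  neg_nonneg.2 (Real.log_nonpos measureReal_nonneg measureReal_le_one)

theorem entropy_nonneg [IsProbabilityMeasure μ] (f : X → α) : 0 ≤ entropy μ f :=
  integral_nonneg (info_nonneg f)

theorem info_congr {f : X → α} {g : X → β} (h : ∀ x y, f x = f y ↔ g x = g y) :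
    info μ f = info μ g := by
  funext x
  have : f ⁻¹' {f x} = g ⁻¹' {g x} := by
    ext y
    simp [h]
  rw [info, info, this]

theorem info_comp_injective {u : α → β} (hu : Function.Injective u) (f : X → α) :
    info μ (u ∘ f) = info μ f :=
  info_congr fun _ _ => hu.eq_iff

theorem entropy_comp_injective {u : α → β} (hu : Function.Injective u) (f : X → α) :
    entropy μ (u ∘ f) = entropy μ f := by
  rw [entropy, entropy, info_comp_injective hu]

theorem ae_pos_fiber [Countable α] [IsProbabilityMeasure μ] (f : X → α) :
    ∀ᵐ x ∂μ, 0 < μ.real (f ⁻¹' {f x}) := by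
  have h : μ (⋃ a ∈ {a | μ (f ⁻¹' {a}) = 0}, f ⁻¹' {a}) = 0 :=
    (measure_biUnion_null_iff (Set.to_countable _)).2 fun a ha => ha
  refine measure_mono_null (fun x hx => ?_) h
  have hx' : ¬ 0 < μ.real (f ⁻¹' {f x}) := hx
  simp only [mem_iUnion]
  refine ⟨f x, ?_, rfl⟩
  have : μ.real (f ⁻¹' {f x}) = 0 := le_antisymm (not_lt.1 hx') measureReal_nonneg
  exact (measureReal_eq_zero_iff).1 this

theorem shannonEntropy_eq [IsProbabilityMeasure μ] [Countable α] {f : X → α}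
    (hf : Integrable (info μ f) μ) : shannonEntropy μ f = ENNReal.ofReal (entropy μ f) :=
  (ofReal_integral_eq_lintegral_ofReal hf (Eventually.of_forall (info_nonneg f))).symm

variable [MeasurableSpace α] [DiscreteMeasurableSpace α] [Countable α]
  [MeasurableSpace β] [DiscreteMeasurableSpace β] [Countable β]
  [MeasurableSpace γ] [DiscreteMeasurableSpace γ] [Countable γ]

theorem measurable_info {f : X → α} (hf : Measurable f) : Measurable (info μ f) :=
  (Measurable.of_discrete (f := fun a => -Real.log (μ.real (f ⁻¹' {a})))).comp hf

/-- Gibbs' inequality: the entropy is at most the mean code length of any code. -/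
theorem gibbs [IsProbabilityMeasure μ] {f : X → α} (hf : Measurable f) {q : α → ℝ}
    (hq : ∀ᵐ x ∂μ, 0 < q (f x)) (hsum : ∑' a, ENNReal.ofReal (q a) ≤ 1)
    (hint : Integrable (fun x => -Real.log (q (f x))) μ) :
    Integrable (info μ f) μ ∧ entropy μ f ≤ ∫ x, -Real.log (q (f x)) ∂μ := by
  -- With `p` the probability of the fibre, `log t ≤ t - 1` at `t = q / p` gives `-log p ≤ -log q +
  -- q / p - 1`, and the ratio `q / p` integrates to at most `∑ q ≤ 1`.
  set R : X → ℝ := fun x => q (f x) / μ.real (f ⁻¹' {f x}) with hR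
  have hRm : Measurable R :=
    (Measurable.of_discrete (f := fun a => q a / μ.real (f ⁻¹' {a}))).comp hf
  have hR0 : 0 ≤ᵐ[μ] R := hq.mono fun x hx => div_nonneg hx.le measureReal_nonneg
  have hlint : ∫⁻ x, ENNReal.ofReal (R x) ∂μ ≤ 1 := by
    have h1 : ∫⁻ x, ENNReal.ofReal (R x) ∂μ
        = ∫⁻ a, ENNReal.ofReal (q a / μ.real (f ⁻¹' {a})) ∂(μ.map f) :=
      (lintegral_map (μ := μ) (f := fun a => ENNReal.ofReal (q a / μ.real (f ⁻¹' {a})))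
        Measurable.of_discrete hf).symm
    rw [h1, lintegral_countable']
    refine le_trans (ENNReal.tsum_le_tsum fun a => ?_) hsum
    rw [Measure.map_apply hf (MeasurableSet.singleton a), ← ofReal_measureReal,
      ← ENNReal.ofReal_mul' measureReal_nonneg]
    rcases eq_or_ne (μ.real (f ⁻¹' {a})) 0 with h | h
    · simp [h]
    · rw [div_mul_cancel₀ _ h]
  have hRint : Integrable R μ := by
    refine ⟨hRm.aestronglyMeasurable, ?_⟩
    rw [hasFiniteIntegral_iff_ofReal hR0]
    exact hlint.trans_lt ENNReal.one_lt_top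
  have hRle : ∫ x, R x ∂μ ≤ 1 := by
    rw [integral_eq_lintegral_of_nonneg_ae hR0 hRm.aestronglyMeasurable]
    exact ENNReal.toReal_le_of_le_ofReal zero_le_one (by simpa using hlint)
  have hle : ∀ᵐ x ∂μ, info μ f x ≤ -Real.log (q (f x)) + R x - 1 := by
    filter_upwards [hq, ae_pos_fiber f] with x hqx hpx
    have := Real.log_le_sub_one_of_pos (div_pos hqx hpx)
    rw [Real.log_div hqx.ne' hpx.ne'] at this
    simp only [info, hR]
    linarith
  have hbound : Integrable (fun x => -Real.log (q (f x)) + R x - 1) μ :=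
    (hint.add hRint).sub (integrable_const 1)
  have hinfo : Integrable (info μ f) μ := by
    refine hbound.mono' (measurable_info hf).aestronglyMeasurable ?_
    filter_upwards [hle] with x hx
    rwa [Real.norm_of_nonneg (info_nonneg f x)]
  refine ⟨hinfo, (integral_mono_ae hinfo hbound hle).trans ?_⟩
  have h1 : ∫ x, (-Real.log (q (f x)) + R x - 1) ∂μ
      = (∫ x, -Real.log (q (f x)) ∂μ + ∫ x, R x ∂μ) - 1 := by
    have h2 := integral_sub (hint.add hRint) (integrable_const (1 : ℝ))
    simp only [Pi.add_apply] at h2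
    rw [h2, integral_add hint hRint]
    simp
  rw [h1]
  linarith

theorem info_le_of_comp [IsProbabilityMeasure μ] (f : X → α) (u : α → β) :
    ∀ᵐ x ∂μ, info μ (u ∘ f) x ≤ info μ f x := by
  filter_upwards [ae_pos_fiber f] with x hx
  refine neg_le_neg (Real.log_le_log hx (measureReal_mono ?_))
  rintro y hy
  simp_all

theorem entropy_comp_le [IsProbabilityMeasure μ] {f : X → α} (u : α → β)
    (hf : Integrable (info μ f) μ) : entropy μ (u ∘ f) ≤ entropy μ f := by
  exact integral_mono_of_nonneg (Eventually.of_forall (info_nonneg _)) hf (info_le_of_comp f u)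

theorem integrable_of_finite_range [IsProbabilityMeasure μ] [Finite α] (g : α → ℝ) {f : X → α}
    (hf : Measurable f) : Integrable (fun x => g (f x)) μ := by
  obtain ⟨C, hC⟩ := (Set.finite_range fun a => ‖g a‖).bddAbove
  exact Integrable.of_bound ((Measurable.of_discrete (f := g)).comp hf).aestronglyMeasurable C
    (Eventually.of_forall fun x => hC ⟨f x, rfl⟩)

theorem integrable_info [IsProbabilityMeasure μ] [Finite α] {f : X → α} (hf : Measurable f) :
    Integrable (info μ f) μ :=
  integrable_of_finite_range (fun a => -Real.log (μ.real (f ⁻¹' {a}))) hf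

/-- Strong subadditivity of entropy, where `u ∘ f = v ∘ g` is the common part of `f` and `g`. -/
theorem entropy_prod_add_le_of_integrable [IsProbabilityMeasure μ]
    {f : X → α} {g : X → β} (hf : Measurable f) (hg : Measurable g) {u : α → γ} {v : β → γ}
    (h : u ∘ f = v ∘ g) (hif : Integrable (info μ f) μ) (hig : Integrable (info μ g) μ)
    (hiu : Integrable (info μ (u ∘ f)) μ) :
    Integrable (info μ fun x => (f x, g x)) μ ∧
      entropy μ (fun x => (f x, g x)) + entropy μ (u ∘ f) ≤ entropy μ f + entropy μ g := by
  classical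
  set p := fun a => μ.real (f ⁻¹' {a})
  set p' := fun b => μ.real (g ⁻¹' {b})
  set r := fun c => μ.real ((u ∘ f) ⁻¹' {c})
  have hfg : Measurable fun x => (f x, g x) := hf.prodMk hg
  -- The code is the law that makes `f` and `g` conditionally independent given their common part;
  -- its code length is the sum of the informations of `f` and `g` minus that of the common part.
  set q : α × β → ℝ := fun ab => if v ab.2 = u ab.1 then p ab.1 / r (u ab.1) * p' ab.2 else 0
  have hsum : ∑' ab, ENNReal.ofReal (q ab) ≤ 1 := by
    have h1 : ∀ a, ∑' b, ENNReal.ofReal (q (a, b)) ≤ μ (f ⁻¹' {a}) := fun a => by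
      have h2 : ∀ b, ENNReal.ofReal (q (a, b)) = ENNReal.ofReal (p a / r (u a)) *
          {b | v b = u a}.indicator (fun b => μ (g ⁻¹' {b})) b := fun b => by
        by_cases hb : v b = u a
        · rw [indicator_of_mem (by exact hb)]
          simp only [q, if_pos hb]
          rw [ENNReal.ofReal_mul' measureReal_nonneg]
          congr 1
          exact ofReal_measureReal
        · rw [indicator_of_notMem (by exact hb)]
          simp [q, hb]
      simp only [h2]
      rw [ENNReal.tsum_mul_left, ← tsum_subtype {b | v b = u a} fun b => μ (g ⁻¹' {b}),
        tsum_measure_preimage_singleton (Set.to_countable _)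
          fun b _ => hg (MeasurableSet.singleton b)]
      have h3 : g ⁻¹' {b | v b = u a} = (u ∘ f) ⁻¹' {u a} := by
        rw [h]
        rfl
      rw [h3, ← ofReal_measureReal, ← ofReal_measureReal (s := f ⁻¹' {a}),
        ← ENNReal.ofReal_mul' measureReal_nonneg]
      refine ENNReal.ofReal_le_ofReal ?_
      rcases eq_or_ne (r (u a)) 0 with h0 | h0
      · rw [h0]
        simp
      · exact (div_mul_cancel₀ _ h0).le
    rw [ENNReal.tsum_prod']
    refine (ENNReal.tsum_le_tsum h1).trans ?_
    have := tsum_measure_preimage_singleton (μ := μ) (f := f) (countable_univ)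
      fun b _ => hf (MeasurableSet.singleton b)
    rw [tsum_univ fun b => μ (f ⁻¹' {b})] at this
    rw [this]
    exact prob_le_one
  have hpos : ∀ᵐ x ∂μ, 0 < q (f x, g x) ∧ -Real.log (q (f x, g x)) =
      info μ f x + info μ g x - info μ (u ∘ f) x := by
    filter_upwards [ae_pos_fiber f, ae_pos_fiber g, ae_pos_fiber (u ∘ f)] with x h1 h2 h3
    have hx : v (g x) = u (f x) := (congrFun h x).symm
    have hqx : q (f x, g x) = p (f x) / r (u (f x)) * p' (g x) := by simp only [q, if_pos hx]
    have h1' : 0 < p (f x) := h1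
    have h2' : 0 < p' (g x) := h2
    have h3' : 0 < r (u (f x)) := h3
    rw [hqx]
    refine ⟨by positivity, ?_⟩
    rw [Real.log_mul (by positivity) h2'.ne', Real.log_div h1'.ne' h3'.ne']
    simp only [info, p, p', r, Function.comp_apply]
    ring
  have hi : Integrable (fun x => -Real.log (q (f x, g x))) μ :=
    ((hif.add hig).sub hiu).congr (hpos.mono fun x hx => hx.2.symm)
  obtain ⟨h4, h5⟩ := gibbs hfg (hpos.mono fun x hx => hx.1) hsum hi
  refine ⟨h4, ?_⟩
  have h2 := integral_sub (μ := μ) (hif.add hig) hiu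
  simp only [Pi.add_apply] at h2
  rw [integral_congr_ae (hpos.mono fun x hx => hx.2), h2, integral_add hif hig] at h5
  simp only [entropy] at h5 ⊢
  linarith

theorem entropy_prod_add_le [IsProbabilityMeasure μ] [Finite α] [Finite β] [Finite γ]
    {f : X → α} {g : X → β} (hf : Measurable f) (hg : Measurable g) (u : α → γ) (v : β → γ)
    (h : u ∘ f = v ∘ g) :
    entropy μ (fun x => (f x, g x)) + entropy μ (u ∘ f) ≤ entropy μ f + entropy μ g :=
  (entropy_prod_add_le_of_integrable hf hg h (integrable_info hf) (integrable_info hg)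
    (integrable_info ((Measurable.of_discrete (f := u)).comp hf))).2

theorem integrable_info_of_lt_top [IsProbabilityMeasure μ] {f : X → α} (hf : Measurable f)
    (h : shannonEntropy μ f < ∞) : Integrable (info μ f) μ :=
  ⟨(measurable_info hf).aestronglyMeasurable,
    (hasFiniteIntegral_iff_ofReal (Eventually.of_forall (info_nonneg f))).2 h⟩

theorem info_comp_measurePreserving {T : X → X} (hT : MeasurePreserving T μ μ) {f : X → α}
    (hf : Measurable f) (x : X) : info μ (f ∘ T) x = info μ f (T x) := by
  simp only [info, preimage_comp, Function.comp_apply]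
  rw [hT.measureReal_preimage (hf (MeasurableSet.singleton _)).nullMeasurableSet]

theorem entropy_comp_measurePreserving {T : X → X} (hT : MeasurePreserving T μ μ) {f : X → α}
    (hf : Measurable f) : entropy μ (f ∘ T) = entropy μ f := by
  simp only [entropy, info_comp_measurePreserving hT hf]
  rw [← integral_map hT.measurable.aemeasurable
    (measurable_info hf).aestronglyMeasurable, hT.map_eq]

end Entropy

/-! ### Følner sequences and submodular functions -/

section Folner

/-- A monotone submodular function dominates a weight that agrees with it on the whole set. -/
theorem exists_weight {ι : Type*} [DecidableEq ι] {φ : Finset ι → ℝ} (h0 : φ ∅ = 0) (hm : Monotone φ)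
    (hs : ∀ A B, φ (A ∪ B) + φ (A ∩ B) ≤ φ A + φ B) (F : Finset ι) :
    ∃ a : ι → ℝ, (∀ g, 0 ≤ a g) ∧ φ F = ∑ g ∈ F, a g ∧ ∀ A ⊆ F, ∑ g ∈ A, a g ≤ φ A := by
  induction F using Finset.induction_on with
  | empty =>
    refine ⟨0, fun _ => le_rfl, by simp [h0], fun A hA => ?_⟩
    simp [Finset.subset_empty.1 hA, h0]
  | insert x F hx ih =>
    obtain ⟨a, ha, hF, hA⟩ := ih
    have hne : ∀ g ∈ F, g ≠ x := fun g hg h => hx (h ▸ hg)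
    have hupd : ∀ (A : Finset ι) (c : ℝ), A ⊆ F →
        ∑ g ∈ A, Function.update a x c g = ∑ g ∈ A, a g := fun A c hAF =>
      Finset.sum_congr rfl fun g hg => Function.update_of_ne (hne g (hAF hg)) _ _
    -- Greedy choice: the new element gets its marginal contribution, and submodularity says that
    -- its contribution to any smaller set is at least as large.
    refine ⟨Function.update a x (φ (insert x F) - φ F), fun g => ?_, ?_, fun A hAF => ?_⟩
    · rcases eq_or_ne g x with rfl | h
      · simpa using hm (Finset.subset_insert _ _)
      · simpa [h] using ha g
    · rw [Finset.sum_insert hx, hupd _ _ subset_rfl, ← hF]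
      simp
    · by_cases hxA : x ∈ A
      · have hI : A.erase x ⊆ F := fun g hg =>
          (Finset.mem_insert.1 (hAF (Finset.mem_of_mem_erase hg))).resolve_left
            (Finset.ne_of_mem_erase hg)
        have h1 := hs A F
        have hU : A ∪ F = insert x F := by
          ext g
          simp only [Finset.mem_union, Finset.mem_insert]
          constructor
          · rintro (h | h)
            · exact Finset.mem_insert.1 (hAF h)
            · exact Or.inr h
          · rintro (rfl | h)
            · exact Or.inl hxA
            · exact Or.inr h
        have hN : A ∩ F = A.erase x := by
          ext g
          simp only [Finset.mem_inter, Finset.mem_erase]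
          exact ⟨fun h => ⟨hne g h.2, h.1⟩, fun h => ⟨h.2, hI (Finset.mem_erase.2 h)⟩⟩
        rw [hU, hN] at h1
        rw [← Finset.add_sum_erase _ _ hxA, hupd _ _ hI]
        have := hA _ hI
        simp only [Function.update_self]
        linarith
      · have hI : A ⊆ F := fun g hg =>
          (Finset.mem_insert.1 (hAF hg)).resolve_left fun h => hxA (h ▸ hg)
        rw [hupd _ _ hI]
        exact hA A hI

variable {G : Type*} [Group G]

/-- The part of `S` that `g` moves out of `S`. -/
def escape [DecidableEq G] (g : G) (S : Finset G) : Finset G :=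
  S.filter fun f => g * f ∉ S

open scoped Pointwise symmDiff in
theorem IsLeftFolner.tendsto_escape [DecidableEq G] {F : ℕ → Finset G} (hF : IsLeftFolner F) (g : G) :
    Tendsto (fun n => ((escape g (F n)).card : ℝ) / ((F n).card : ℝ)) atTop (𝓝 0) := by
  obtain ⟨hne, hF⟩ := hF
  let _ : MeasurableSpace G := ⊤
  have h := hF.tendsto_meas_smul_symmDiff g
  have h' := (ENNReal.tendsto_toReal ENNReal.zero_ne_top).comp h
  refine squeeze_zero (fun n => by positivity) (fun n => ?_) h'
  have hc : (Measure.count (F n : Set G)) = ((F n).card : ℝ≥0∞) := Measure.count_apply_finset _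
  simp only [Function.comp_apply, ENNReal.toReal_div, hc, ENNReal.toReal_natCast]
  refine div_le_div_of_nonneg_right ?_ (by positivity)
  have hs : (g • (F n : Set G)) ∆ (F n : Set G)
      = (((F n).image (g * ·) ∆ F n : Finset G) : Set G) := by
    rw [Finset.coe_symmDiff, Finset.coe_image]
    rfl
  rw [hs, Measure.count_apply_finset, ENNReal.toReal_natCast, Nat.cast_le,
    ← Finset.card_image_of_injective _ (mul_right_injective g)]
  refine Finset.card_le_card fun x hx => ?_
  obtain ⟨f, hf, rfl⟩ := Finset.mem_image.1 hx
  rw [escape, Finset.mem_filter] at hf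
  rw [Finset.mem_symmDiff]
  exact Or.inl ⟨Finset.mem_image_of_mem _ hf.1, hf.2⟩

/-- Double count of `∑ a (k * g)` over `k ∈ K` and those `g` with `K g ⊆ F`, where `a` is the weight
dominated by `φ`. For fixed `g` the sum is at most `φ (K g) = φ K`. For fixed `k` it is `φ F` up to
the elements of `F` that are missed; these number at most the total escape, and each weighs at most
`φ {1}`. -/
theorem submodular_le_of_translates [DecidableEq G] {φ : Finset G → ℝ} (h0 : φ ∅ = 0)
    (hm : Monotone φ) (hs : ∀ A B, φ (A ∪ B) + φ (A ∩ B) ≤ φ A + φ B)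
    (hinv : ∀ A g, φ (A.image (· * g)) = φ A) (K F : Finset G) :
    (K.card : ℝ) * φ F ≤ F.card * φ K + K.card * ((∑ k ∈ K, ((escape k F).card : ℝ)) * φ {1}) := by
  obtain ⟨a, ha, hF, hA⟩ := exists_weight h0 hm hs F
  have hφ0 : ∀ A, 0 ≤ φ A := fun A => h0 ▸ hm (Finset.empty_subset A)
  have h1 : ∀ g, φ {g} = φ {1} := fun g => by simpa using hinv {1} g
  set F' := F.filter fun g => ∀ k ∈ K, k * g ∈ F with hF'
  have hcard : (F.card : ℝ) ≤ F'.card + ∑ k ∈ K, ((escape k F).card : ℝ) := by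
    have hsub : F ⊆ F' ∪ K.biUnion fun k => escape k F := fun g hg => by
      by_cases h : ∀ k ∈ K, k * g ∈ F
      · exact Finset.mem_union_left _ (Finset.mem_filter.2 ⟨hg, h⟩)
      · push Not at h
        obtain ⟨k, hk, hkg⟩ := h
        refine Finset.mem_union_right _ (Finset.mem_biUnion.2 ⟨k, hk, ?_⟩)
        exact Finset.mem_filter.2 ⟨hg, hkg⟩
    have := (Finset.card_le_card hsub).trans ((Finset.card_union_le _ _).trans
      (Nat.add_le_add_left Finset.card_biUnion_le _))
    exact_mod_cast this
  have hupper : ∑ g ∈ F', ∑ k ∈ K, a (k * g) ≤ F.card * φ K := by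
    have h2 : ∀ g ∈ F', ∑ k ∈ K, a (k * g) ≤ φ K := fun g hg => by
      rw [← hinv K g, ← Finset.sum_image (f := a) (g := (· * g))
        fun x _ y _ h => mul_right_cancel h]
      refine hA _ fun f hf => ?_
      obtain ⟨k, hk, rfl⟩ := Finset.mem_image.1 hf
      exact (Finset.mem_filter.1 hg).2 k hk
    refine (Finset.sum_le_card_nsmul _ _ _ h2).trans ?_
    rw [nsmul_eq_mul]
    exact mul_le_mul_of_nonneg_right
      (by exact_mod_cast Finset.card_le_card (Finset.filter_subset _ _)) (hφ0 K)
  have hlower : ∀ k ∈ K,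
      φ F - (∑ k ∈ K, ((escape k F).card : ℝ)) * φ {1} ≤ ∑ g ∈ F', a (k * g) := fun k hk => by
    have hsub : F'.image (k * ·) ⊆ F := fun f hf => by
      obtain ⟨g, hg, rfl⟩ := Finset.mem_image.1 hf
      exact (Finset.mem_filter.1 hg).2 k hk
    rw [← Finset.sum_image (f := a) (g := (k * ·)) fun x _ y _ h => mul_left_cancel h, hF,
      ← Finset.sum_sdiff hsub]
    have h3 : ∑ g ∈ F \ F'.image (k * ·), a g ≤ (∑ k ∈ K, ((escape k F).card : ℝ)) * φ {1} := by
      refine (Finset.sum_le_card_nsmul _ _ (φ {1}) fun g hg => ?_).trans ?_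
      · have := hA {g} (Finset.singleton_subset_iff.2 (Finset.mem_sdiff.1 hg).1)
        rwa [Finset.sum_singleton, h1] at this
      · rw [nsmul_eq_mul]
        refine mul_le_mul_of_nonneg_right ?_ (hφ0 _)
        rw [Finset.card_sdiff_of_subset hsub,
          Finset.card_image_of_injective _ (mul_right_injective k),
          Nat.cast_sub (Finset.card_le_card (Finset.filter_subset _ _))]
        linarith
    linarith
  have h4 := Finset.card_nsmul_le_sum K _ _ hlower
  rw [nsmul_eq_mul, Finset.sum_comm, mul_sub] at h4
  linarith

/-- After division by `|F n|` the escape terms vanish. A bound along a subsequence is enough, so a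
positive upper limit can be used without proving that the limit exists. -/
theorem submodular_ge_of_frequently [DecidableEq G] {φ : Finset G → ℝ} (h0 : φ ∅ = 0)
    (hm : Monotone φ) (hs : ∀ A B, φ (A ∪ B) + φ (A ∩ B) ≤ φ A + φ B)
    (hinv : ∀ A g, φ (A.image (· * g)) = φ A) {F : ℕ → Finset G} (hF : IsLeftFolner F) {c : ℝ}
    (hc : ∃ᶠ n in atTop, c * (F n).card ≤ φ (F n)) (K : Finset G) :
    c * K.card ≤ φ K := by
  have hlim : Tendsto (fun n => K.card * ((∑ k ∈ K, ((escape k (F n)).card : ℝ) / (F n).card)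
      * φ {1})) atTop (𝓝 0) := by
    have := ((tendsto_finsetSum K fun k _ => hF.tendsto_escape k).mul_const (φ {1})).const_mul
      (K.card : ℝ)
    simpa using this
  refine le_of_forall_pos_le_add fun ε hε => ?_
  obtain ⟨n, hn, hn'⟩ := (hc.and_eventually (hlim.eventually (gt_mem_nhds hε))).exists
  have hpos : (0 : ℝ) < (F n).card := by exact_mod_cast (hF.1 n).card_pos
  have h1 := submodular_le_of_translates h0 hm hs hinv K (F n)
  rw [← Finset.sum_div, div_mul_eq_mul_div, mul_div_assoc', div_lt_iff₀ hpos] at hn'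
  have h2 : (K.card : ℝ) * (c * (F n).card) ≤ K.card * φ (F n) :=
    mul_le_mul_of_nonneg_left hn (by positivity)
  refine le_of_mul_le_mul_right ?_ hpos
  linarith

end Folner

/-! ### The entropy of names as an invariant submodular function of the finite set -/

section RefineEntropy

variable {G X α : Type*} [Group G] [MulAction G X] [MeasurableSpace X] [MeasurableConstSMul G X]
  {μ : Measure X} [IsProbabilityMeasure μ] [MeasurableSpace α]

theorem measurable_refine (S : Finset G) {ξ : X → α} (hξ : Measurable ξ) :
    Measurable (refine S ξ) :=
  measurable_pi_lambda _ fun g => hξ.comp (measurable_const_smul (g : G))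

variable [DiscreteMeasurableSpace α] [Fintype α]

theorem entropy_refine_mono [DecidableEq G] {ξ : X → α} (hξ : Measurable ξ) :
    Monotone fun S : Finset G => entropy μ (refine S ξ) := fun A B hAB =>
  entropy_comp_le (f := refine B ξ) (fun w (g : A) => w ⟨g, hAB g.2⟩)
    (integrable_info (measurable_refine B hξ))

/-- Strong subadditivity for the names over `A` and `B`, whose common part is the name over `A ∩ B`;
jointly they carry the same information as the name over `A ∪ B`. -/
theorem entropy_refine_submodular [DecidableEq G] {ξ : X → α} (hξ : Measurable ξ)
    (A B : Finset G) : entropy μ (refine (A ∪ B) ξ) + entropy μ (refine (A ∩ B) ξ)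
      ≤ entropy μ (refine A ξ) + entropy μ (refine B ξ) := by
  have h := entropy_prod_add_le (μ := μ) (measurable_refine A hξ) (measurable_refine B hξ)
    (fun w (g : (A ∩ B : Finset G)) => w ⟨g, Finset.mem_of_mem_inter_left g.2⟩)
    (fun w (g : (A ∩ B : Finset G)) => w ⟨g, Finset.mem_of_mem_inter_right g.2⟩) rfl
  let ψ : ((A ∪ B : Finset G) → α) → (A → α) × (B → α) := fun w =>
    (fun g => w ⟨g, Finset.mem_union_left _ g.2⟩, fun g => w ⟨g, Finset.mem_union_right _ g.2⟩)
  have hψ : Function.Injective ψ := fun w w' hw => by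
    funext ⟨g, hg⟩
    rcases Finset.mem_union.1 hg with h | h
    · exact congrFun (Prod.mk.inj hw).1 ⟨g, h⟩
    · exact congrFun (Prod.mk.inj hw).2 ⟨g, h⟩
  have h' := entropy_comp_injective (μ := μ) hψ (refine (A ∪ B) ξ)
  rw [← h']
  exact h

theorem entropy_refine_translate [DecidableEq G] [SMulInvariantMeasure G X μ] {ξ : X → α}
    (hξ : Measurable ξ) (A : Finset G) (g : G) :
    entropy μ (refine (A.image (· * g)) ξ) = entropy μ (refine A ξ) := by
  let ψ : (A.image (· * g) → α) → (A → α) := fun w a =>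
    w ⟨a * g, Finset.mem_image_of_mem _ a.2⟩
  have hψ : Function.Injective ψ := fun w w' hw => by
    funext ⟨b, hb⟩
    obtain ⟨a, ha, rfl⟩ := Finset.mem_image.1 hb
    exact congrFun hw ⟨a, ha⟩
  rw [← entropy_comp_injective hψ,
    ← entropy_comp_measurePreserving (measurePreserving_smul g μ) (measurable_refine A hξ)]
  congr 1
  funext x a
  simp [ψ, refine, mul_smul]

theorem entropy_refine_empty (ξ : X → α) : entropy μ (refine (∅ : Finset G) ξ) = 0 := by
  have h : ∀ x, refine (∅ : Finset G) ξ ⁻¹' {refine (∅ : Finset G) ξ x} = univ := fun x =>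
    eq_univ_of_forall fun y => Subsingleton.elim _ _
  simp [entropy, info, h]

/-- The entropy of a finite partition is at least linear along all finite sets if it is so
along a subsequence of a Følner sequence. -/
theorem entropy_refine_ge [SMulInvariantMeasure G X μ] {F : ℕ → Finset G} (hF : IsLeftFolner F)
    {ξ : X → α} (hξ : Measurable ξ) {c : ℝ}
    (hc : ∃ᶠ n in atTop, c * (F n).card ≤ entropy μ (refine (F n) ξ)) (K : Finset G) :
    c * K.card ≤ entropy μ (refine K ξ) := by
  classical
  exact submodular_ge_of_frequently (entropy_refine_empty ξ) (entropy_refine_mono hξ)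
    (entropy_refine_submodular hξ) (entropy_refine_translate hξ) hF hc K

end RefineEntropy

/-! ### Reduction to finite partitions -/

section Truncation

variable {G X δ : Type*} [Group G] [MulAction G X] [MeasurableSpace X]
  {μ : Measure X} [IsProbabilityMeasure μ]

/-- In conditional form, `H(ξ | f, u ∘ ξ) ≤ H(ξ | u ∘ ξ)`: strong subadditivity with common part `u
∘ ξ`. -/
theorem entropy_prod_coarse [MeasurableSpace δ] [DiscreteMeasurableSpace δ] [Countable δ]
    {f : X → δ} {ξ : X → ℕ} {u : ℕ → ℕ} (hf : Measurable f) (hξ : Measurable ξ)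
    (h1 : Integrable (info μ fun x => (f x, u (ξ x))) μ) (h2 : Integrable (info μ ξ) μ)
    (h3 : Integrable (info μ (u ∘ ξ)) μ) :
    Integrable (info μ fun x => (f x, ξ x)) μ ∧ entropy μ (fun x => (f x, ξ x)) ≤
      entropy μ (fun x => (f x, u (ξ x))) + (entropy μ ξ - entropy μ (u ∘ ξ)) := by
  have h := entropy_prod_add_le_of_integrable (μ := μ) (f := fun x => (f x, u (ξ x)))
    (hf.prodMk (Measurable.of_discrete.comp hξ)) hξ (u := Prod.snd) (v := u) rfl h1 h2 h3
  have hc : info μ (fun x => ((f x, u (ξ x)), ξ x)) = info μ fun x => (f x, ξ x) :=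
    info_congr fun x y => by
      simp only [Prod.mk.injEq]
      exact ⟨fun h => ⟨h.1.1, h.2⟩, fun h => ⟨⟨h.1, congrArg u h.2⟩, h.2⟩⟩
  rw [entropy, hc] at h
  refine ⟨h.1, ?_⟩
  have h4 : entropy μ (fun x => (f x, ξ x)) + entropy μ (u ∘ ξ) ≤ _ := h.2
  linarith

theorem refine_insert_eq_iff [DecidableEq G] {α : Type*} (g : G) (S : Finset G) (ξ : X → α)
    (x y : X) : refine (insert g S) ξ x = refine (insert g S) ξ y ↔
      ξ (g • x) = ξ (g • y) ∧ refine S ξ x = refine S ξ y := by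
  simp [funext_iff, refine]

variable [MeasurableConstSMul G X] [SMulInvariantMeasure G X μ]

/-- The coordinates are coarsened one at a time, each at a cost of at most `H(ξ) - H(u ∘ ξ)`. The
auxiliary `f` is there for the induction: it absorbs the coordinate already coarsened, so its
codomain has to vary. -/
theorem entropy_refine_coarse {ξ : X → ℕ} {u : ℕ → ℕ} (hξ : Measurable ξ)
    (h2 : Integrable (info μ ξ) μ) (h3 : Integrable (info μ (u ∘ ξ)) μ) (S : Finset G) :
    ∀ (δ : Type) [MeasurableSpace δ] [DiscreteMeasurableSpace δ] [Countable δ] (f : X → δ),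
      Measurable f → Integrable (info μ fun x => (f x, refine S (u ∘ ξ) x)) μ →
      Integrable (info μ fun x => (f x, refine S ξ x)) μ ∧
        entropy μ (fun x => (f x, refine S ξ x)) ≤ entropy μ (fun x => (f x, refine S (u ∘ ξ) x))
          + S.card * (entropy μ ξ - entropy μ (u ∘ ξ)) := by
  classical
  have huξ : Measurable (u ∘ ξ) := Measurable.of_discrete.comp hξ
  induction S using Finset.induction_on with
  | empty =>
    intro δ _ _ _ f hf hi
    have hc : info μ (fun x => (f x, refine (∅ : Finset G) ξ x))
        = info μ (fun x => (f x, refine (∅ : Finset G) (u ∘ ξ) x)) := info_congr fun x y => by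
      simp [funext_iff]
    rw [entropy, hc]
    refine ⟨hi, ?_⟩
    simp [entropy]
  | insert g S hg ih =>
    intro δ _ _ _ f hf hi
    have hm := measurable_const_smul (α := X) g
    have e1 : info μ (fun x => (f x, refine (insert g S) (u ∘ ξ) x))
        = info μ (fun x => ((f x, u (ξ (g • x))), refine S (u ∘ ξ) x)) := info_congr fun x y => by
      simp only [Prod.mk.injEq, refine_insert_eq_iff, Function.comp_apply, and_assoc]
    have e2 : info μ (fun x => ((f x, u (ξ (g • x))), refine S ξ x))
        = info μ (fun x => ((f x, refine S ξ x), u (ξ (g • x)))) := info_congr fun x y => by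
      simp only [Prod.mk.injEq]
      tauto
    have e3 : info μ (fun x => (f x, refine (insert g S) ξ x))
        = info μ (fun x => ((f x, refine S ξ x), ξ (g • x))) := info_congr fun x y => by
      simp only [Prod.mk.injEq, refine_insert_eq_iff]
      tauto
    rw [e1] at hi
    obtain ⟨i1, l1⟩ := ih (δ × ℕ) (fun x => (f x, u (ξ (g • x)))) (hf.prodMk (huξ.comp hm)) hi
    rw [e2] at i1
    have hT := measurePreserving_smul g μ
    have k2 : Integrable (info μ (ξ ∘ (g • ·))) μ := by
      rw [funext (info_comp_measurePreserving hT hξ)]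
      exact hT.integrable_comp_of_integrable h2
    have k3 : Integrable (info μ (u ∘ ξ ∘ (g • ·))) μ := by
      rw [← Function.comp_assoc, funext (info_comp_measurePreserving hT huξ)]
      exact hT.integrable_comp_of_integrable h3
    obtain ⟨i2, l2⟩ := entropy_prod_coarse (f := fun x => (f x, refine S ξ x))
      (hf.prodMk (measurable_refine S hξ)) (hξ.comp hm) i1 k2 k3
    rw [entropy_comp_measurePreserving hT hξ, ← Function.comp_assoc,
      entropy_comp_measurePreserving hT huξ] at l2
    rw [entropy, entropy, e3, e1, Finset.card_insert_of_notMem hg]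
    refine ⟨i2, ?_⟩
    simp only [entropy, e2, Function.comp_apply] at l1 l2 ⊢
    push_cast
    linarith

/-- The values of `ξ` from `m` on are identified. -/
def truncate (m : ℕ) (ξ : X → ℕ) (x : X) : Fin (m + 1) :=
  ⟨min (ξ x) m, by omega⟩

theorem measurable_truncate (m : ℕ) {ξ : X → ℕ} (hξ : Measurable ξ) :
    Measurable (truncate m ξ) :=
  (Measurable.of_discrete (f := fun k : ℕ => (⟨min k m, by omega⟩ : Fin (m + 1)))).comp hξ

/-- Truncation leaves the fibres below `m` unchanged, so the loss of entropy is at most the integral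
of the information function over `{m ≤ ξ}`, the tail of a convergent integral. -/
theorem tendsto_entropy_sub_truncate {ξ : X → ℕ} (hξ : Measurable ξ)
    (hi : Integrable (info μ ξ) μ) :
    ∀ ε > 0, ∃ m, entropy μ ξ - entropy μ (truncate m ξ) < ε := by
  intro ε hε
  have hlim : Tendsto (fun m => ∫ x in {x | m ≤ ξ x}, info μ ξ x ∂μ) atTop
      (𝓝 (∫ x in ⋂ m, {x | m ≤ ξ x}, info μ ξ x ∂μ)) :=
    tendsto_setIntegral_of_antitone (fun m => hξ measurableSet_Ici)
      (fun a b hab x hx => le_trans hab hx) ⟨0, hi.integrableOn⟩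
  have he : ⋂ m, {x | m ≤ ξ x} = ∅ := by
    refine eq_empty_of_forall_notMem fun x hx => ?_
    have : ξ x + 1 ≤ ξ x := mem_iInter.1 hx (ξ x + 1)
    omega
  rw [he, setIntegral_empty] at hlim
  obtain ⟨m, hm⟩ := (hlim.eventually (gt_mem_nhds hε)).exists
  refine ⟨m, lt_of_le_of_lt ?_ hm⟩
  have hms : MeasurableSet {x | m ≤ ξ x} := hξ measurableSet_Ici
  have h3 := integrable_info (μ := μ) (measurable_truncate m hξ)
  rw [← integral_indicator hms, entropy, entropy, ← integral_sub hi h3]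
  refine integral_mono (hi.sub h3) (hi.indicator hms) fun x => ?_
  by_cases hx : m ≤ ξ x
  · rw [indicator_of_mem (by exact hx)]
    have := info_nonneg (μ := μ) (truncate m ξ) x
    linarith
  · rw [indicator_of_notMem (by exact hx)]
    have : truncate m ξ ⁻¹' {truncate m ξ x} = ξ ⁻¹' {ξ x} := by
      ext y
      simp only [truncate, mem_preimage, mem_singleton_iff, Fin.mk.injEq]
      omega
    simp [info, this]

/-- An action of positive entropy has a finite partition whose refinements have at least linear
entropy. -/
theorem exists_finite_partition_of_measureEntropy_pos {F : ℕ → Finset G} (hF : IsLeftFolner F)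
    (h : 0 < measureEntropy μ F) :
    ∃ (m : ℕ) (ξ : X → Fin (m + 1)) (c : ℝ), Measurable ξ ∧ 0 < c ∧
      ∀ K : Finset G, c * K.card ≤ entropy μ (refine K ξ) := by
  simp only [measureEntropy, lt_iSup_iff] at h
  obtain ⟨ξ, hξ, hfin, h⟩ := h
  have hi := integrable_info_of_lt_top hξ hfin
  obtain ⟨c, hc, hcl⟩ := ENNReal.lt_iff_exists_nnreal_btwn.1 h
  have hc0 : (0 : ℝ) < c := by exact_mod_cast hc
  -- Truncation costs less than `c / 2` per group element, so a rate `c / 2` survives.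
  obtain ⟨m, hm⟩ := tendsto_entropy_sub_truncate hξ hi (c / 2) (half_pos hc0)
  have hmt := measurable_truncate m hξ
  refine ⟨m, truncate m ξ, c / 2, hmt, half_pos hc0,
    entropy_refine_ge hF hmt ((frequently_lt_of_lt_limsup (by isBoundedDefault) hcl).mono
      fun n hn => ?_)⟩
  set u : ℕ → ℕ := fun k => min k m
  have ht : info μ (u ∘ ξ) = info μ (truncate m ξ) := info_congr fun x y => by
    simp [truncate, u]
  have hr : info μ (fun x => ((), refine (F n) (u ∘ ξ) x))
      = info μ (refine (F n) (truncate m ξ)) := info_congr fun x y => by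
    simp [truncate, u, refine, funext_iff]
  have hr' : info μ (fun x => ((), refine (F n) ξ x)) = info μ (refine (F n) ξ) :=
    info_congr fun x y => by simp
  obtain ⟨h1, h2⟩ := entropy_refine_coarse hξ hi (u := u) (by
    rw [ht]
    exact integrable_info hmt) (F n) Unit (fun _ => ()) measurable_const (by
    rw [hr]
    exact integrable_info (measurable_refine _ hmt))
  rw [hr'] at h1
  simp only [entropy, hr, hr', ht] at h2
  simp only [entropy] at hm
  have hpos : (0 : ℝ) < (F n).card := by exact_mod_cast (hF.1 n).card_pos
  rw [shannonEntropy_eq h1, ENNReal.lt_div_iff_mul_lt (by simp [(hF.1 n).ne_empty]) (by simp),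
    ← ENNReal.ofReal_coe_nnreal, ← ENNReal.ofReal_natCast, ← ENNReal.ofReal_mul' hpos.le] at hn
  have hn' := (ENNReal.ofReal_lt_ofReal_iff_of_nonneg (by positivity)).1 hn
  simp only [entropy] at hn' ⊢
  nlinarith

end Truncation

/-! ### Sets that are regular with respect to a semimetric -/

section Regular

variable {G X : Type*} [Group G] [MulAction G X] [MeasurableSpace X]
  {μ : Measure X} [IsProbabilityMeasure μ] {ρ : X → X → ℝ}

/-- The dense points given by admissibility may have non-integrable distance functions. By Fubini
almost every point has an integrable one, so each dense point is replaced, at every precision `1 /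
(n + 1)`, by such a point nearby whenever there is one. -/
theorem exists_dense_sequence (hρ : IsMeasurableSemimetric μ ρ) (ha : IsAdmissible μ ρ)
    (hs : Integrable (fun p : X × X => ρ p.1 p.2) (μ.prod μ)) :
    ∃ d : ℕ → X, (∀ i, Integrable (ρ (d i)) μ) ∧
      ∀ᵐ x ∂μ, ∀ r > 0, ∃ i, ρ (d i) x < r := by
  obtain ⟨X₀, hX₀, D, -, hDc, hD⟩ := ha
  have hY : ∀ᵐ x ∂μ, x ∈ X₀ ∧ Integrable (ρ x) μ := hs.prod_right_ae.and hX₀ |>.mono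
    fun x hx => ⟨hx.2, hx.1⟩
  obtain ⟨y₀, hy₀⟩ := hY.exists
  have hDne : Nonempty D := by
    obtain ⟨d, hd, -⟩ := hD y₀ hy₀.1 1 one_pos
    exact ⟨⟨d, hd⟩⟩
  have hex : ∀ p : D × ℕ, ∃ y, Integrable (ρ y) μ ∧
      ((∃ z, Integrable (ρ z) μ ∧ ρ p.1 z < 1 / (p.2 + 1 : ℝ)) →
        ρ p.1 y < 1 / (p.2 + 1 : ℝ)) := fun p => by
    by_cases h : ∃ z, Integrable (ρ z) μ ∧ ρ p.1 z < 1 / (p.2 + 1 : ℝ)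
    · obtain ⟨z, hz⟩ := h
      exact ⟨z, hz.1, fun _ => hz.2⟩
    · exact ⟨y₀, hy₀.2, fun h' => absurd h' h⟩
  choose t ht1 ht2 using hex
  have := hDc.to_subtype
  obtain ⟨e, he⟩ := exists_surjective_nat (D × ℕ)
  refine ⟨fun i => t (e i), fun i => ht1 _, hY.mono fun x hx r hr => ?_⟩
  obtain ⟨n, hn⟩ := exists_nat_one_div_lt (half_pos hr)
  obtain ⟨d, hd, hxd⟩ := hD x hx.1 (1 / (n + 1 : ℝ)) Nat.one_div_pos_of_nat
  obtain ⟨i, hi⟩ := he (⟨d, hd⟩, n)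
  refine ⟨i, ?_⟩
  have h1 := ht2 (⟨d, hd⟩, n) ⟨x, hx.2, by rw [hρ.symm]; exact hxd⟩
  simp only [hi]
  have h2 := hρ.triangle (t (⟨d, hd⟩, n)) d x
  rw [hρ.symm _ d, hρ.symm d x] at h2
  simp only at h1
  linarith

/-- Off a set of small measure, points on different sides of `A` are at a distance bounded below
in a finite sum of shifts of `ρ`. -/
def IsRegular (G : Type*) [Group G] [MulAction G X] (μ : Measure X) (ρ : X → X → ℝ)
    (A : Set X) : Prop :=
  NullMeasurableSet A μ ∧ ∀ κ : ℝ≥0∞, κ ≠ 0 → ∃ B : Set X, μ B ≤ κ ∧ ∃ C : ℝ, 0 ≤ C ∧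
    ∃ S : Finset G, ∀ x ∉ B, ∀ y ∉ B, x ∈ A → y ∉ A → 1 ≤ C * ∑ g ∈ S, ρ (g • x) (g • y)

theorem IsRegular.congr {A A' : Set X} (hA : IsRegular G μ ρ A) (h : A =ᵐ[μ] A') :
    IsRegular G μ ρ A' := by
  refine ⟨hA.1.congr h, fun κ hκ => ?_⟩
  obtain ⟨B, hB, C, hC, S, hS⟩ := hA.2 κ hκ
  have hN : μ {x | ¬ (x ∈ A ↔ x ∈ A')} = 0 := eventuallyEq_set.1 h
  refine ⟨B ∪ {x | ¬ (x ∈ A ↔ x ∈ A')}, (measure_union_le _ _).trans (by simpa [hN] using hB), C,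
    hC, S, fun x hx y hy hxA hyA => ?_⟩
  simp only [mem_union, mem_ofPred_eq, not_or, not_not] at hx hy
  exact hS x hx.1 y hy.1 (hx.2.2 hxA) fun h => hyA (hy.2.1 h)

theorem IsRegular.compl (hρ : IsMeasurableSemimetric μ ρ) {A : Set X} (hA : IsRegular G μ ρ A) :
    IsRegular G μ ρ Aᶜ := by
  refine ⟨hA.1.compl, fun κ hκ => ?_⟩
  obtain ⟨B, hB, C, hC, S, hS⟩ := hA.2 κ hκ
  refine ⟨B, hB, C, hC, S, fun x hx y hy hxA hyA => ?_⟩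
  simp only [hρ.symm _ (_ • y)]
  exact hS y hy x hx (not_not.1 hyA) hxA

/-- A finite subunion exhausts the union up to measure `κ / 2`, and the exceptional sets of the `A
i` are chosen with total measure below `κ / 2`. For the remaining points, one `A i` of the subunion
already separates them. -/
theorem IsRegular.iUnion (hρ : IsMeasurableSemimetric μ ρ) {A : ℕ → Set X}
    (hA : ∀ i, IsRegular G μ ρ (A i)) : IsRegular G μ ρ (⋃ i, A i) := by
  classical
  have hU : NullMeasurableSet (⋃ i, A i) μ := NullMeasurableSet.iUnion fun i => (hA i).1
  refine ⟨hU, fun κ hκ => ?_⟩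
  have hκ2 : κ / 2 ≠ 0 := (ENNReal.half_pos hκ).ne'
  obtain ⟨δ, hδ, hδsum⟩ := ENNReal.exists_pos_sum_of_countable' hκ2 ℕ
  choose B hB C hC S hS using fun i => (hA i).2 (δ i) (hδ i).ne'
  have hlim : Tendsto (fun m => μ ((⋃ i, A i) \ ⋃ i ∈ Finset.range m, A i)) atTop
      (𝓝 (μ (⋂ m, (⋃ i, A i) \ ⋃ i ∈ Finset.range m, A i))) := by
    refine tendsto_measure_iInter_atTop (fun m => hU.diff
      (NullMeasurableSet.biUnion (Finset.countable_toSet _) fun i _ => (hA i).1)) ?_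
      ⟨0, measure_ne_top _ _⟩
    intro a b hab
    refine sdiff_subset_sdiff_right (biUnion_subset_biUnion_left fun i hi => ?_)
    exact Finset.mem_coe.2 (Finset.mem_range.2 ((Finset.mem_range.1 hi).trans_le hab))
  have he : ⋂ m, (⋃ i, A i) \ ⋃ i ∈ Finset.range m, A i = ∅ := by
    refine eq_empty_of_forall_notMem fun x hx => ?_
    rw [mem_iInter] at hx
    obtain ⟨i, hi⟩ := mem_iUnion.1 (hx 0).1
    exact (hx (i + 1)).2 (mem_biUnion (Finset.mem_range.2 (Nat.lt_succ_self i)) hi)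
  rw [he, measure_empty] at hlim
  obtain ⟨m, hm⟩ := (hlim.eventually (gt_mem_nhds (pos_iff_ne_zero.2 hκ2))).exists
  refine ⟨((⋃ i, A i) \ ⋃ i ∈ Finset.range m, A i) ∪ ⋃ i ∈ Finset.range m, B i, ?_,
    ∑ i ∈ Finset.range m, C i, Finset.sum_nonneg fun i _ => hC i,
    (Finset.range m).biUnion S, fun x hx y hy hxA hyA => ?_⟩
  · refine (measure_union_le _ _).trans ?_
    rw [← ENNReal.add_halves κ]
    refine add_le_add hm.le ((measure_biUnion_finset_le _ _).trans ?_)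
    refine (Finset.sum_le_sum fun i _ => hB i).trans ?_
    exact (ENNReal.sum_le_tsum _).trans hδsum.le
  · simp only [mem_union, not_or] at hx hy
    have hx' : x ∈ ⋃ i ∈ Finset.range m, A i := by
      by_contra h
      exact hx.1 ⟨hxA, h⟩
    obtain ⟨i, hi, hxi⟩ := mem_iUnion₂.1 hx'
    have h1 := hS i x (fun h => hx.2 (mem_biUnion hi h)) y (fun h => hy.2 (mem_biUnion hi h)) hxi
      fun h => hyA (mem_iUnion_of_mem i h)
    refine h1.trans (mul_le_mul (Finset.single_le_sum (fun j _ => hC j) hi) ?_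
      (Finset.sum_nonneg fun g _ => hρ.nonneg _ _) (Finset.sum_nonneg fun j _ => hC j))
    exact Finset.sum_le_sum_of_subset_of_nonneg (Finset.subset_biUnion_of_mem S hi)
      fun g _ _ => hρ.nonneg _ _

/-- The regular sets form a `σ`-algebra. -/
@[reducible]
def regularSpace (G : Type*) [Group G] [MulAction G X] (hρ : IsMeasurableSemimetric μ ρ) :
    MeasurableSpace X where
  MeasurableSet' := IsRegular G μ ρ
  measurableSet_empty := ⟨nullMeasurableSet_empty, fun κ _ =>
    ⟨∅, by simp, 0, le_rfl, ∅, fun x _ y _ hx => absurd hx (notMem_empty x)⟩⟩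
  measurableSet_compl _ hA := hA.compl hρ
  measurableSet_iUnion _ hA := IsRegular.iUnion hρ hA

variable [MeasurableConstSMul G X] [SMulInvariantMeasure G X μ]

/-- Discarding a thin annulus inside the boundary leaves a gap of `1 / (n + 1)` between inside and
outside, by the triangle inequality. The annuli decrease to the empty set, so their measures tend to
zero. -/
theorem isRegular_ball (hρ : IsMeasurableSemimetric μ ρ) {d : X} (hd : AEMeasurable (ρ d) μ)
    (g : G) (r : ℝ) : IsRegular G μ ρ {x | ρ d (g • x) < r} := by
  have hdg : AEMeasurable (fun x => ρ d (g • x)) μ :=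
    hd.comp_quasiMeasurePreserving (measurePreserving_smul g μ).quasiMeasurePreserving
  have hm : ∀ s : ℝ, NullMeasurableSet {x | ρ d (g • x) < s} μ := fun s =>
    nullMeasurableSet_lt hdg aemeasurable_const
  refine ⟨hm r, fun κ hκ => ?_⟩
  have hlim : Tendsto
      (fun n : ℕ => μ ({x | ρ d (g • x) < r} \ {x | ρ d (g • x) < r - 1 / (n + 1 : ℝ)})) atTop
      (𝓝 (μ (⋂ n : ℕ, {x | ρ d (g • x) < r} \ {x | ρ d (g • x) < r - 1 / (n + 1 : ℝ)}))) := by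
    refine tendsto_measure_iInter_atTop (fun n => (hm r).diff (hm _)) ?_ ⟨0, measure_ne_top _ _⟩
    intro a b hab
    refine sdiff_subset_sdiff_right ?_
    intro x (hx : ρ d (g • x) < r - 1 / (a + 1 : ℝ))
    have : 1 / (b + 1 : ℝ) ≤ 1 / (a + 1 : ℝ) := Nat.one_div_le_one_div hab
    exact lt_of_lt_of_le hx (by linarith)
  have he : ⋂ n : ℕ, {x | ρ d (g • x) < r} \ {x | ρ d (g • x) < r - 1 / (n + 1 : ℝ)} = ∅ := by
    refine eq_empty_of_forall_notMem fun x hx => ?_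
    rw [mem_iInter] at hx
    have h0 : ρ d (g • x) < r := (hx 0).1
    obtain ⟨n, hn⟩ := exists_nat_one_div_lt (sub_pos.2 h0)
    exact (hx n).2 (show ρ d (g • x) < r - 1 / (n + 1 : ℝ) by linarith)
  rw [he, measure_empty] at hlim
  obtain ⟨n, hn⟩ := (hlim.eventually (gt_mem_nhds (pos_iff_ne_zero.2 hκ))).exists
  have hn0 : (0 : ℝ) < n + 1 := by positivity
  refine ⟨_, hn.le, n + 1, hn0.le, {g}, fun x hx y _ hxA hyA => ?_⟩
  have h1 : ρ d (g • x) < r - 1 / (n + 1 : ℝ) := by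
    by_contra h
    exact hx ⟨hxA, h⟩
  have h2 : r ≤ ρ d (g • y) := not_lt.1 hyA
  have h3 := hρ.triangle d (g • x) (g • y)
  rw [Finset.sum_singleton]
  calc (1 : ℝ) = (n + 1) * (1 / (n + 1)) := by field_simp
    _ ≤ _ := mul_le_mul_of_nonneg_left (by linarith) hn0.le

/-- For a generating semimetric, all measurable sets are regular. -/
theorem IsSuitableSemimetric.isRegular [Countable G] [StandardBorelSpace X] {F : ℕ → Finset G}
    (hρ : IsSuitableSemimetric μ F ρ) {A : Set X} (hA : MeasurableSet A) :
    IsRegular G μ ρ A := by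
  obtain ⟨d, hd, hdense⟩ :=
    exists_dense_sequence hρ.semimetric hρ.admissible hρ.summable
  obtain ⟨X₀, hX₀, hgen⟩ := hρ.generating
  -- Countably many shifted balls of rational radius; they are regular and, off a null set, separate
  -- points.
  let E : G × ℕ × ℚ → Set X := fun i => {x | ρ (d i.2.1) (i.1 • x) < i.2.2}
  have hE : ∀ i, IsRegular G μ ρ (E i) := fun i =>
    isRegular_ball hρ.semimetric (hd i.2.1).aestronglyMeasurable.aemeasurable i.1 i.2.2
  -- The balls are only null measurable. Borel copies are needed to obtain a Borel coding map `Φ'`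
  -- below.
  choose E' hE'm hE' using fun i => (hE i).1
  have hgood : ∀ᵐ x ∂μ, x ∈ X₀ ∧ (∀ g : G, ∀ r > 0, ∃ i, ρ (d i) (g • x) < r) ∧
      ∀ i, x ∈ E i ↔ x ∈ E' i := by
    refine Filter.Eventually.and hX₀ (Filter.Eventually.and ?_ ?_)
    · refine ae_all_iff.2 fun g => ?_
      exact (measurePreserving_smul g μ).quasiMeasurePreserving.ae hdense
    · exact ae_all_iff.2 fun i => eventuallyEq_set.1 (hE' i)
  obtain ⟨N, hN, hNm, hN0⟩ := exists_measurable_superset_of_null (ae_iff.1 hgood)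
  have hY : ∀ x ∉ N, x ∈ X₀ ∧ (∀ g : G, ∀ r > 0, ∃ i, ρ (d i) (g • x) < r) ∧
      ∀ i, x ∈ E i ↔ x ∈ E' i := fun x hx => by
    by_contra h
    exact hx (hN h)
  have hsep : ∀ x ∉ N, ∀ y ∉ N, (∀ i, x ∈ E i ↔ y ∈ E i) → x = y := fun x hx y hy h => by
    by_contra hxy
    obtain ⟨n, g, -, hg⟩ := hgen x (hY x hx).1 y (hY y hy).1 hxy
    obtain ⟨i, hi⟩ := (hY x hx).2.1 g (ρ (g • x) (g • y) / 4) (by positivity)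
    -- A ball of radius below half the distance of `g • x` and `g • y` cannot contain both.
    obtain ⟨r, hr1, hr2⟩ := exists_rat_btwn (show ρ (g • x) (g • y) / 4 < ρ (g • x) (g • y) / 2 by
      linarith)
    have h1 : y ∈ E (g, i, r) := (h (g, i, r)).1 (show ρ (d i) (g • x) < r by linarith)
    have h2 : ρ (d i) (g • y) < r := h1
    have h3 := hρ.semimetric.triangle (g • x) (d i) (g • y)
    rw [hρ.semimetric.symm (g • x) (d i)] at h3
    linarith
  let Φ : X → (G × ℕ × ℚ → Prop) := fun x i => x ∈ E i
  let Φ' : X → (G × ℕ × ℚ → Prop) := fun x i => x ∈ E' i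
  have hΦ' : Measurable Φ' := measurable_pi_lambda _ fun i => (hE'm i).mem
  have hΦ : @Measurable _ _ (regularSpace G hρ.semimetric) _ Φ :=
    @measurable_pi_lambda _ _ _ (regularSpace G hρ.semimetric) _ _ fun i =>
      @MeasurableSet.mem _ (E i) (regularSpace G hρ.semimetric)
        (show @MeasurableSet X (regularSpace G hρ.semimetric) (E i) from hE i)
  have hΦΦ' : ∀ x ∉ N, Φ x = Φ' x := fun x hx =>
    funext fun i => propext ((hY x hx).2.2 i)
  -- Lusin–Souslin: the injective Borel image of a Borel set is Borel. Its preimage under `Φ` is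
  -- regular and agrees with `A` off `N`.
  have himg : MeasurableSet (Φ' '' (A \ N)) := by
    refine (hA.diff hNm).image_of_measurable_injOn hΦ' fun x hx y hy h => ?_
    rw [← hΦΦ' x hx.2, ← hΦΦ' y hy.2] at h
    exact hsep x hx.2 y hy.2 fun i => by rw [show x ∈ E i ↔ Φ x i from Iff.rfl, h]
  have hreg : IsRegular G μ ρ (Φ ⁻¹' (Φ' '' (A \ N))) := hΦ himg
  refine hreg.congr (eventuallyEq_set.2 ?_)
  have hNae : ∀ᵐ x ∂μ, x ∉ N := measure_eq_zero_iff_ae_notMem.1 hN0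
  refine hNae.mono fun x hx => ⟨?_, fun hxA => ⟨x, ⟨hxA, hx⟩, (hΦΦ' x hx).symm⟩⟩
  rintro ⟨y, hy, hxy⟩
  rw [← hΦΦ' y hy.2] at hxy
  rw [← hsep y hy.2 x hx fun i => by rw [show y ∈ E i ↔ Φ y i from Iff.rfl, hxy]]
  exact hy.1

end Regular

/-! ### Upper bounds for the `ε`-entropy -/

section Upper

variable {G X α : Type*} [Group G] [MulAction G X] [MeasurableSpace X]
  {μ : Measure X} [IsProbabilityMeasure μ] {ρ : X → X → ℝ}

theorem diam_le_ofReal {A : Set X} {c : ℝ} (h : ∀ x ∈ A, ∀ y ∈ A, ρ x y ≤ c) :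
    diam ρ A ≤ ENNReal.ofReal c :=
  iSup₂_le fun x hx => iSup₂_le fun y hy => ENNReal.ofReal_le_ofReal (h x hx y hy)

theorem measure_lt_ofReal_iff {A : Set X} {ε : ℝ} : μ A < ENNReal.ofReal ε ↔ μ.real A < ε :=
  ENNReal.lt_ofReal_iff_toReal_lt (measure_ne_top μ A)

/-- The cells are the fibres over `W`, outside a measurable hull of the bad set. Surplus cells are
empty; allowing `k` to exceed `W.card` covers the case of an empty `W`. -/
theorem epsEntropy_le_of_names [MeasurableSpace α] [MeasurableSingletonClass α] {f : X → α}
    (hf : Measurable f) (W : Finset α) {Bad : Set X} {ε c : ℝ} (hcε : c < ε) (hε : 0 < ε)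
    (hBad : μ.real (Bad ∪ {x | f x ∉ W}) < ε)
    (h : ∀ x ∉ Bad, ∀ y ∉ Bad, f x = f y → ρ x y ≤ c) {k : ℕ} (hk : W.card ≤ k) (hk1 : 1 ≤ k) :
    epsEntropy μ ρ ε ≤ ENNReal.ofReal (Real.logb 2 k) := by
  refine iInf₂_le_of_le k hk1 (iInf_le _ ?_)
  set X₀ := toMeasurable μ (Bad ∪ {x | f x ∉ W})
  have hX₀ : MeasurableSet X₀ := measurableSet_toMeasurable _ _
  have hsub : Bad ∪ {x | f x ∉ W} ⊆ X₀ := subset_toMeasurable _ _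
  classical
  refine ⟨X₀, fun i => if hi : (i : ℕ) < W.card then
    f ⁻¹' {(W.equivFin.symm ⟨i, hi⟩ : α)} \ X₀ else ∅, hX₀, fun i => ?_, ?_, ?_, fun i => ?_⟩
  · dsimp only
    split_ifs
    · exact (hf (MeasurableSet.singleton _)).diff hX₀
    · exact MeasurableSet.empty
  · refine eq_univ_of_forall fun x => ?_
    by_cases hx : x ∈ X₀
    · exact Or.inl hx
    · have hW : f x ∈ W := by
        by_contra hW
        exact hx (hsub (Or.inr hW))
      refine Or.inr (mem_iUnion.2 ⟨⟨W.equivFin ⟨f x, hW⟩, (W.equivFin ⟨f x, hW⟩).2.trans_le hk⟩,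
        ?_⟩)
      rw [dif_pos (W.equivFin ⟨f x, hW⟩).2]
      exact ⟨by simp, hx⟩
  · rw [measure_toMeasurable]
    exact measure_lt_ofReal_iff.2 hBad
  · refine lt_of_le_of_lt (diam_le_ofReal (c := c) ?_) ((ENNReal.ofReal_lt_ofReal_iff hε).2 hcε)
    intro x hx y hy
    dsimp only at hx hy
    split_ifs at hx hy with hi
    · exact h x (fun hb => hx.2 (hsub (Or.inl hb))) y (fun hb => hy.2 (hsub (Or.inl hb)))
        ((mem_singleton_iff.1 hx.1).trans (mem_singleton_iff.1 hy.1).symm)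
    · exact absurd hx (notMem_empty x)

/-- A finite partition with cells of small diameter, up to one cell on which the distance to a
base point has small integral. -/
theorem exists_small_partition (hρ : IsMeasurableSemimetric μ ρ) (ha : IsAdmissible μ ρ)
    (hs : Integrable (fun p : X × X => ρ p.1 p.2) (μ.prod μ)) {ε δ : ℝ} (hε : 0 < ε)
    (hδ : 0 < δ) :
    ∃ (m : ℕ) (η : X → Fin (m + 1)) (u : X → ℝ), Measurable η ∧ Integrable u μ ∧
      (∀ x, 0 ≤ u x) ∧ ∫ x, u x ∂μ < δ ∧ ∀ x y, η x = η y → ρ x y ≤ ε + u x + u y := by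
  classical
  obtain ⟨d, hd, hdense⟩ := exists_dense_sequence hρ ha hs
  have hE : ∀ i, NullMeasurableSet {x | ρ (d i) x < ε / 2} μ := fun i =>
    nullMeasurableSet_lt (hd i).aestronglyMeasurable.aemeasurable aemeasurable_const
  choose A hAE hAm hAeq using fun i => (hE i).exists_measurable_subset_ae_eq
  -- `R m` is what the first `m` balls miss. It becomes the last cell, with index `m`; there `ρ x y`
  -- is bounded through the base point `d 0`, and the integral of `ρ (d 0)` over `R m` tends to
  -- zero.
  set R : ℕ → Set X := fun m => ⋂ i ∈ Finset.range m, (A i)ᶜ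
  have hRm : ∀ m, MeasurableSet (R m) := fun m =>
    (Finset.range m).measurableSet_biInter fun i _ => (hAm i).compl
  have hRanti : Antitone R := fun a b hab => biInter_subset_biInter_left fun i hi =>
    Finset.mem_coe.2 (Finset.mem_range.2 ((Finset.mem_range.1 hi).trans_le hab))
  have hnull : μ (⋂ m, R m) = 0 := by
    refine measure_eq_zero_iff_ae_notMem.2 ?_
    filter_upwards [hdense, ae_all_iff.2 fun i => eventuallyEq_set.1 (hAeq i)] with x hx hxA hxR
    obtain ⟨i, hi⟩ := hx (ε / 2) (half_pos hε)
    exact mem_iInter₂.1 (mem_iInter.1 hxR (i + 1)) i (Finset.self_mem_range_succ i)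
      ((hxA i).2 hi)
  have hlim := tendsto_setIntegral_of_antitone (μ := μ) (f := ρ (d 0)) hRm hRanti
    ⟨0, (hd 0).integrableOn⟩
  rw [setIntegral_measure_zero _ hnull] at hlim
  obtain ⟨m, hm⟩ := (hlim.eventually (gt_mem_nhds hδ)).exists
  have hp : ∀ x, ∃ n, x ∈ A n ∨ n = m := fun x => ⟨m, Or.inr rfl⟩
  have hle : ∀ x, Nat.find (hp x) ≤ m := fun x => Nat.find_min' _ (Or.inr rfl)
  have hmeas : Measurable fun x => Nat.find (hp x) := by
    refine measurable_find hp fun k => ?_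
    by_cases hk : k = m
    · simp [hk]
    · simpa [hk] using hAm k
  have hmeas' : Measurable fun x => (⟨Nat.find (hp x), Nat.lt_succ_of_le (hle x)⟩ : Fin (m + 1)) :=
    measurable_to_countable' fun i => by
      have : (fun x => (⟨Nat.find (hp x), Nat.lt_succ_of_le (hle x)⟩ : Fin (m + 1))) ⁻¹' {i}
          = (fun x => Nat.find (hp x)) ⁻¹' {(i : ℕ)} := by
        ext x
        simp [Fin.ext_iff]
      rw [this]
      exact hmeas (MeasurableSet.singleton _)
  refine ⟨m, fun x => ⟨Nat.find (hp x), Nat.lt_succ_of_le (hle x)⟩,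
    (R m).indicator (ρ (d 0)), hmeas', (hd 0).indicator (hRm m),
    fun x => indicator_nonneg (fun x _ => hρ.nonneg _ _) x, ?_, fun x y hxy => ?_⟩
  · rwa [integral_indicator (hRm m)]
  · simp only [Fin.mk.injEq] at hxy
    have hu : ∀ z, 0 ≤ (R m).indicator (ρ (d 0)) z := fun z =>
      indicator_nonneg (fun x _ => hρ.nonneg _ _) z
    have hspec := fun z => Nat.find_spec (hp z)
    by_cases hx : Nat.find (hp x) = m
    · have hR : ∀ z, Nat.find (hp z) = m → z ∈ R m := fun z hz =>
        mem_iInter₂.2 fun i hi hzi => Nat.find_min (hp z)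
          ((Finset.mem_range.1 hi).trans_eq hz.symm) (Or.inl hzi)
      rw [indicator_of_mem (hR x hx), indicator_of_mem (hR y (hxy.symm.trans hx))]
      have := hρ.triangle x (d 0) y
      rw [hρ.symm x (d 0)] at this
      linarith
    · have h1 : x ∈ A (Nat.find (hp x)) := (hspec x).resolve_right hx
      have h2 : y ∈ A (Nat.find (hp x)) := by
        rw [hxy]
        exact (hspec y).resolve_right fun h => hx (hxy.trans h)
      have h3 : ρ (d (Nat.find (hp x))) x < ε / 2 := hAE _ h1
      have h4 : ρ (d (Nat.find (hp x))) y < ε / 2 := hAE _ h2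
      have := hρ.triangle x (d (Nat.find (hp x))) y
      rw [hρ.symm x (d _)] at this
      linarith [hu x, hu y]

variable [MeasurableConstSMul G X] [SMulInvariantMeasure G X μ]

theorem measure_average_ge_le {u : X → ℝ} (hu : Integrable u μ) (h0 : ∀ x, 0 ≤ u x)
    {S : Finset G} (hS : S.Nonempty) {t : ℝ} (ht : 0 < t) :
    μ.real {x | t * S.card ≤ ∑ g ∈ S, u (g • x)} ≤ (∫ x, u x ∂μ) / t := by
  have hpos : (0 : ℝ) < S.card := by exact_mod_cast hS.card_pos
  have hint : ∀ g : G, Integrable (fun x => u (g • x)) μ := fun g =>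
    (measurePreserving_smul g μ).integrable_comp_of_integrable hu
  have h := mul_meas_ge_le_integral_of_nonneg (μ := μ) (f := fun x => ∑ g ∈ S, u (g • x))
    (Eventually.of_forall fun x => Finset.sum_nonneg fun g _ => h0 _)
    (integrable_finsetSum S fun g _ => hint g) (t * S.card)
  rw [integral_finsetSum S fun g _ => hint g] at h
  have hinv : ∀ g : G, ∫ x, u (g • x) ∂μ = ∫ x, u x ∂μ := fun g => by
    have hT := measurePreserving_smul g μ
    have := integral_map (μ := μ) hT.measurable.aemeasurable
      (f := u) (by rw [hT.map_eq]; exact hu.aestronglyMeasurable)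
    rw [← this, hT.map_eq]
  simp only [hinv, Finset.sum_const, nsmul_eq_mul] at h
  rw [le_div_iff₀ ht]
  refine le_of_mul_le_mul_right ?_ hpos
  linarith

/-- The bound `ε / 4 + u x + u y` is averaged over `S`. Off `Bad` the averages of `u` at `x` and `y`
are below `ε / 4`, hence `3 * ε / 4`. The integral bound `ε / 4 * (ε / 2)` makes Markov's inequality
give `ε / 2`, which leaves room for discarding rare names. -/
theorem exists_names_partition (hρ : IsMeasurableSemimetric μ ρ) (ha : IsAdmissible μ ρ)
    (hs : Integrable (fun p : X × X => ρ p.1 p.2) (μ.prod μ)) {ε : ℝ} (hε : 0 < ε) :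
    ∃ (m : ℕ) (η : X → Fin (m + 1)), Measurable η ∧ ∀ S : Finset G, S.Nonempty →
      ∃ Bad : Set X, μ.real Bad ≤ ε / 2 ∧ ∀ x ∉ Bad, ∀ y ∉ Bad,
        refine S η x = refine S η y → average S ρ x y ≤ 3 * ε / 4 := by
  obtain ⟨m, η, u, hη, hu, hu0, huδ, hηu⟩ :=
    exists_small_partition hρ ha hs (show 0 < ε / 4 by positivity)
      (show 0 < ε / 4 * (ε / 2) by positivity)
  refine ⟨m, η, hη, fun S hS => ⟨_, (measure_average_ge_le hu hu0 hS
    (show 0 < ε / 4 by positivity)).trans ?_, fun x hx y hy hxy => ?_⟩⟩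
  · rw [div_le_iff₀ (by positivity)]
    linarith
  · have hx' := not_le.1 (show ¬ ε / 4 * S.card ≤ ∑ g ∈ S, u (g • x) from hx)
    have hy' := not_le.1 (show ¬ ε / 4 * S.card ≤ ∑ g ∈ S, u (g • y) from hy)
    have hpos : (0 : ℝ) < S.card := by exact_mod_cast hS.card_pos
    rw [average, inv_mul_le_iff₀ hpos]
    have : ∑ g ∈ S, ρ (g • x) (g • y) ≤ ∑ g ∈ S, (ε / 4 + u (g • x) + u (g • y)) :=
      Finset.sum_le_sum fun g hg => hηu _ _ (congrFun hxy ⟨g, hg⟩)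
    simp only [Finset.sum_add_distrib, Finset.sum_const, nsmul_eq_mul] at this
    linarith

theorem exists_epsEntropy_le_card (hρ : IsMeasurableSemimetric μ ρ) (ha : IsAdmissible μ ρ)
    (hs : Integrable (fun p : X × X => ρ p.1 p.2) (μ.prod μ)) {ε : ℝ} (hε : 0 < ε) :
    ∃ C : ℝ≥0, 0 < C ∧ ∀ S : Finset G, S.Nonempty →
      epsEntropy μ (average S ρ) ε ≤ C * S.card := by
  classical
  obtain ⟨m, η, hη, h⟩ := exists_names_partition (G := G) hρ ha hs hε
  have h0 : 0 ≤ Real.logb 2 (m + 1 : ℝ) :=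
    Real.logb_nonneg (by norm_num) (by linarith [m.cast_nonneg (α := ℝ)])
  -- The summand `1` keeps the constant positive when `m = 0`.
  refine ⟨(Real.logb 2 (m + 1 : ℝ)).toNNReal + 1, by positivity, fun S hS => ?_⟩
  obtain ⟨Bad, hBad, hav⟩ := h S hS
  have hBad' : μ.real (Bad ∪ {x | refine S η x ∉ Finset.univ}) < ε := by
    have : {x | refine S η x ∉ Finset.univ} = ∅ := eq_empty_of_forall_notMem fun x hx =>
      hx (Finset.mem_univ _)
    rw [this, union_empty]
    linarith
  refine (epsEntropy_le_of_names (measurable_refine S hη) Finset.univ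
    (show 3 * ε / 4 < ε by linarith) hε hBad' hav (k := (m + 1) ^ S.card) (by simp)
    (Nat.one_le_pow _ _ m.succ_pos)).trans ?_
  push_cast
  rw [Real.logb_pow, ENNReal.ofReal_mul (by positivity), ENNReal.ofReal_natCast, mul_comm]
  gcongr
  exact le_self_add

/-- Only names of probability at least `exp (-δ |F n|)` are kept; there are at most `exp (δ |F n|)`
of them. The others have total measure below `ε / 2` by Markov's inequality for the information
function, once the entropy rate is below `ε / 2 * δ`. -/
theorem tendsto_epsEntropy_div_card (hρ : IsMeasurableSemimetric μ ρ) (ha : IsAdmissible μ ρ)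
    (hs : Integrable (fun p : X × X => ρ p.1 p.2) (μ.prod μ)) {F : ℕ → Finset G}
    (hF : ∀ n, (F n).Nonempty) (h0 : ∀ (m : ℕ) (η : X → Fin (m + 1)), Measurable η →
      Tendsto (fun n => entropy μ (refine (F n) η) / (F n).card) atTop (𝓝 0))
    {ε : ℝ} (hε : 0 < ε) :
    Tendsto (fun n => epsEntropy μ (average (F n) ρ) ε / ((F n).card : ℝ≥0∞)) atTop (𝓝 0) := by
  classical
  obtain ⟨m, η, hη, h⟩ := exists_names_partition (G := G) hρ ha hs hε
  have key : ∀ δ : ℝ, 0 < δ → ∀ᶠ n in atTop,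
      epsEntropy μ (average (F n) ρ) ε ≤ ENNReal.ofReal (δ / Real.log 2 * (F n).card) := by
    intro δ hδ
    filter_upwards [(h0 m η hη).eventually (gt_mem_nhds (show 0 < ε / 2 * δ by positivity))]
      with n hn
    have hpos : (0 : ℝ) < (F n).card := by exact_mod_cast (hF n).card_pos
    obtain ⟨Bad, hBad, hav⟩ := h (F n) (hF n)
    have hf := measurable_refine (F n) hη
    set f := refine (F n) η
    set W : Finset (F n → Fin (m + 1)) :=
      Finset.univ.filter fun w => Real.exp (-(δ * (F n).card)) ≤ μ.real (f ⁻¹' {w}) with hW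
    have hWcard : (W.card : ℝ) ≤ Real.exp (δ * (F n).card) := by
      have h1 := Finset.card_nsmul_le_sum W (fun w => μ.real (f ⁻¹' {w}))
        (Real.exp (-(δ * (F n).card))) fun w hw => (Finset.mem_filter.1 hw).2
      have h2 : ∑ w ∈ W, μ.real (f ⁻¹' {w}) ≤ 1 := by
        rw [← measureReal_biUnion_finset (fun a _ b _ hab => Disjoint.preimage _ (by simpa using hab))
          (fun a _ => hf (MeasurableSet.singleton a)) fun _ _ => measure_ne_top _ _]
        exact measureReal_le_one
      rw [nsmul_eq_mul, Real.exp_neg, ← div_eq_mul_inv] at h1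
      exact (div_le_one (Real.exp_pos _)).1 (h1.trans h2)
    have hWbad : μ.real {x | f x ∉ W} < ε / 2 := by
      have hsub : μ.real {x | f x ∉ W} ≤ μ.real {x | δ * (F n).card ≤ info μ f x} := by
        refine ENNReal.toReal_mono (measure_ne_top _ _) (measure_mono_ae ?_)
        filter_upwards [ae_pos_fiber f] with x hx hxW
        have hxW' : ¬ Real.exp (-(δ * (F n).card)) ≤ μ.real (f ⁻¹' {f x}) := fun h =>
          hxW (Finset.mem_filter.2 ⟨Finset.mem_univ _, h⟩)
        have := (Real.log_le_iff_le_exp hx).2 (not_le.1 hxW').le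
        show δ * (F n).card ≤ -Real.log _
        linarith
      have hM := mul_meas_ge_le_integral_of_nonneg (μ := μ)
        (Eventually.of_forall (info_nonneg f)) (integrable_info hf) (δ * (F n).card)
      rw [div_lt_iff₀ hpos] at hn
      refine hsub.trans_lt (lt_of_mul_lt_mul_left (hM.trans_lt (hn.trans_eq ?_)) (by positivity))
      ring
    refine (epsEntropy_le_of_names hf W (show 3 * ε / 4 < ε by linarith) hε
      ((measureReal_union_le _ _).trans_lt (by linarith)) hav (le_max_right 1 _)
      (le_max_left 1 _)).trans (ENNReal.ofReal_le_ofReal ?_)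
    have hk : (0 : ℝ) < (max 1 W.card : ℕ) := by exact_mod_cast (le_max_left 1 W.card)
    rw [Real.logb, div_mul_eq_mul_div]
    refine div_le_div_of_nonneg_right ((Real.log_le_iff_le_exp hk).2 ?_)
      (Real.log_nonneg one_le_two)
    push_cast
    exact max_le (Real.one_le_exp (by positivity)) hWcard
  refine ENNReal.tendsto_nhds_zero.2 fun t ht => ?_
  obtain ⟨s, hs0, hst⟩ := ENNReal.lt_iff_exists_nnreal_btwn.1 ht
  have hs0' : (0 : ℝ) < s := by exact_mod_cast hs0
  have hlog : 0 < Real.log 2 := Real.log_pos one_lt_two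
  filter_upwards [key (s * Real.log 2) (by positivity)] with n hn
  refine (ENNReal.div_le_of_le_mul (hn.trans_eq ?_)).trans hst.le
  rw [mul_div_cancel_right₀ _ hlog.ne', ENNReal.ofReal_mul hs0'.le, ENNReal.ofReal_natCast,
    ENNReal.ofReal_coe_nnreal]

end Upper

/-! ### Lower bounds for the `ε`-entropy -/

section Hamming

variable {X ι α : Type*} [MeasurableSpace X] {μ : Measure X} [IsProbabilityMeasure μ]
  [Fintype ι] [DecidableEq ι] [Fintype α] [DecidableEq α] [Nonempty α]

/-- The exponential rate of the size of a Hamming ball of relative radius `r` over an alphabet with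
`a` letters, up to the contribution of exceptional words. -/
noncomputable def hammingRate (a : ℕ) (r : ℝ) : ℝ :=
  -2 * Real.log (1 - r) + 3 * (r * Real.log a) - 3 * (r * Real.log r)

theorem exists_hammingRate_le (a : ℕ) {c : ℝ} (hc : 0 < c) :
    ∃ r, 0 < r ∧ r < 1 ∧ hammingRate a r ≤ c := by
  have h1 : ContinuousAt (fun r : ℝ => Real.log (1 - r)) 0 :=
    ContinuousAt.log (by fun_prop) (by norm_num)
  have h2 : ContinuousAt (hammingRate a) 0 :=
    ((h1.const_mul (-2)).add (by fun_prop)).sub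
      (Real.continuous_mul_log.continuousAt.const_mul 3)
  have h3 : Tendsto (hammingRate a) (𝓝[>] 0) (𝓝 0) := by
    have := h2.tendsto.mono_left (nhdsWithin_le_nhds (s := Ioi 0))
    simpa [hammingRate] using this
  obtain ⟨r, hr, hr'⟩ := ((h3.eventually (ge_mem_nhds hc)).and
    (Ioo_mem_nhdsGT (zero_lt_one' ℝ))).exists
  exact ⟨r, hr'.1, hr'.2, hr⟩

/-- The sum factors over the coordinates, and each factor is at most `(1 - r) + r`. The weight is a
subprobability that models a copy of `c` with error rate `r`. -/
theorem sum_hammingWeight_le_one {r : ℝ} (hr0 : 0 < r) (hr1 : r < 1) (c : ι → α) :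
    ∑ w : ι → α, ∏ s, (if w s = c s then 1 - r else r / Fintype.card α) ≤ 1 := by
  have h := Finset.prod_univ_sum (fun _ : ι => (Finset.univ : Finset α))
    fun s b => if b = c s then 1 - r else r / Fintype.card α
  rw [Fintype.piFinset_univ] at h
  rw [← h]
  have ha : (0 : ℝ) < Fintype.card α := by exact_mod_cast Fintype.card_pos
  refine Finset.prod_le_one (fun s _ => Finset.sum_nonneg fun b _ => ?_) fun s _ => ?_
  · split_ifs <;> [linarith; positivity]
  · have h1 : ∀ b : α, (if b = c s then 1 - r else r / Fintype.card α)
        ≤ (if b = c s then 1 - r else 0) + r / Fintype.card α := fun b => by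
      split_ifs
      · exact le_add_of_nonneg_right (by positivity)
      · simp
    refine (Finset.sum_le_sum fun b _ => h1 b).trans ?_
    rw [Finset.sum_add_distrib, Finset.sum_ite_eq' Finset.univ (c s)]
    simp only [Finset.mem_univ, if_true, Finset.sum_const, Finset.card_univ, nsmul_eq_mul]
    rw [mul_div_cancel₀ _ ha.ne']
    linarith

/-- If, off a set of measure at most `2r`, the words `f x` lie in `k` Hamming balls of relative
radius `r`, then the entropy of `f` is at most `log k` plus a small multiple of the length. -/
theorem entropy_le_of_hamming [MeasurableSpace α] [DiscreteMeasurableSpace α] [Nonempty ι]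
    {f : X → ι → α} (hf : Measurable f) {r : ℝ} (hr0 : 0 < r) (hr1 : r < 1) {Bad : Set X}
    (hBad : μ.real Bad ≤ 2 * r) {k : ℕ} (hk : 1 ≤ k) (c : Fin k → ι → α)
    (h : ∀ x ∉ Bad, ∃ i, ((Finset.univ.filter fun s => f x s ≠ c i s).card : ℝ)
      ≤ r * Fintype.card ι) :
    entropy μ f ≤ Real.log k + Fintype.card ι * hammingRate (Fintype.card α) r := by
  set a : ℝ := ((Fintype.card α : ℕ) : ℝ) with ha_def
  set N := Fintype.card ι with hN_def
  have ha : (1 : ℝ) ≤ a := Nat.one_le_cast.2 Fintype.card_pos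
  have ha0 : 0 < a := one_pos.trans_le ha
  have hN : (1 : ℝ) ≤ N := Nat.one_le_cast.2 Fintype.card_pos
  have hk0 : (0 : ℝ) < k := by exact_mod_cast hk
  have h1r : 0 < 1 - r := by linarith
  have hlogr : Real.log r ≤ 0 := Real.log_nonpos hr0.le hr1.le
  have hlog1r : Real.log (1 - r) ≤ 0 := Real.log_nonpos h1r.le (by linarith)
  have hloga : 0 ≤ Real.log a := Real.log_nonneg ha
  have hlogk : 0 ≤ Real.log k := Real.log_nonneg (by exact_mod_cast hk)
  set P : Fin k → (ι → α) → ℝ := fun i w => ∏ s, (if w s = c i s then 1 - r else r / a)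
  have hP0 : ∀ i w, 0 < P i w := fun i w => Finset.prod_pos fun s _ => by
    split_ifs <;> positivity
  -- The code mixes the uniform law, with weight `r`, and the mean of the noisy copies of the `k`
  -- centres, with weight `1 - r`. The first bounds the code length `E₁` of every word, the second
  -- gives the better bound `E₂` for words near a centre.
  set q : (ι → α) → ℝ := fun w => r * (a ^ N)⁻¹ + (1 - r) * ((k : ℝ)⁻¹ * ∑ i, P i w)
  have hq1 : ∀ w, r * (a ^ N)⁻¹ ≤ q w := fun w =>
    le_add_of_nonneg_right (mul_nonneg h1r.le (mul_nonneg (by positivity)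
      (Finset.sum_nonneg fun i _ => (hP0 i w).le)))
  have hq2 : ∀ w i, (1 - r) * ((k : ℝ)⁻¹ * P i w) ≤ q w := fun w i => by
    have : P i w ≤ ∑ i, P i w :=
      Finset.single_le_sum (fun i _ => (hP0 i w).le) (Finset.mem_univ i)
    refine le_add_of_nonneg_of_le (by positivity) ?_
    gcongr
  have hqpos : ∀ w, 0 < q w := fun w => lt_of_lt_of_le (by positivity) (hq1 w)
  have hsum : ∑ w, q w ≤ 1 := by
    have h1 : ∑ w : ι → α, r * (a ^ N)⁻¹ = r := by
      rw [Finset.sum_const, nsmul_eq_mul, Finset.card_univ, Fintype.card_fun]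
      push_cast
      rw [← ha_def, ← hN_def]
      field_simp
    have h2 : ∑ w : ι → α, ∑ i, P i w ≤ k := by
      rw [Finset.sum_comm]
      refine (Finset.sum_le_card_nsmul _ _ 1 fun i _ => sum_hammingWeight_le_one hr0 hr1 (c i)).trans ?_
      simp
    simp only [q]
    rw [Finset.sum_add_distrib, h1, ← Finset.mul_sum, ← Finset.mul_sum]
    have h3 : (k : ℝ)⁻¹ * ∑ w : ι → α, ∑ i, P i w ≤ 1 := by
      rw [inv_mul_le_iff₀ hk0]
      linarith
    nlinarith
  have hint : Integrable (fun x => -Real.log (q (f x))) μ :=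
    integrable_of_finite_range (fun w => -Real.log (q w)) hf
  have hg := (gibbs (μ := μ) hf (Eventually.of_forall fun x => hqpos (f x)) (by
    rw [tsum_fintype, ← ENNReal.ofReal_sum_of_nonneg fun w _ => (hqpos w).le]
    simpa using hsum) hint).2
  set E₁ : ℝ := -Real.log r + N * Real.log a
  set E₂ : ℝ := -Real.log (1 - r) + Real.log k - N * Real.log (1 - r)
    + r * N * (Real.log a - Real.log r)
  have hE₁ : 0 ≤ E₁ := add_nonneg (by linarith) (by positivity)
  have hE₂ : 0 ≤ E₂ := by
    have h1 : (N : ℝ) * Real.log (1 - r) ≤ 0 := mul_nonpos_of_nonneg_of_nonpos (by positivity) hlog1r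
    have h2 : 0 ≤ r * N * (Real.log a - Real.log r) := mul_nonneg (by positivity) (by linarith)
    simp only [E₂]
    linarith
  have hall : ∀ x, -Real.log (q (f x)) ≤ E₁ := fun x => by
    have := Real.log_le_log (by positivity) (hq1 (f x))
    rw [Real.log_mul hr0.ne' (by positivity), Real.log_inv, Real.log_pow] at this
    simp only [E₁]
    linarith
  have hgood : ∀ x ∉ Bad, -Real.log (q (f x)) ≤ E₂ := fun x hx => by
    obtain ⟨i, hi⟩ := h x hx
    set d := (Finset.univ.filter fun s => f x s ≠ c i s).card
    -- A factor `1 - r` is charged at mismatches too, which only lowers the bound and avoids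
    -- counting the matches.
    have hP : (1 - r) ^ N * (r / a) ^ d ≤ P i (f x) := by
      have h1 : (1 - r) ^ N * (r / a) ^ d
          = ∏ s, ((1 - r) * if f x s ≠ c i s then r / a else 1) := by
        rw [Finset.prod_mul_distrib, Finset.prod_const, Finset.card_univ, ← Finset.prod_filter,
          Finset.prod_const]
      rw [h1]
      refine Finset.prod_le_prod (fun s _ => by split_ifs <;> positivity) fun s _ => ?_
      by_cases hs : f x s = c i s
      · simp [hs]
      · simp only [hs, ne_eq, not_false_eq_true, if_true, if_false]
        exact mul_le_of_le_one_left (by positivity) (by linarith)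
    have h2 : (1 - r) * ((k : ℝ)⁻¹ * ((1 - r) ^ N * (r / a) ^ d)) ≤ q (f x) := by
      refine le_trans ?_ (hq2 (f x) i)
      gcongr
    have h3 := Real.log_le_log (by positivity) h2
    rw [Real.log_mul h1r.ne' (by positivity), Real.log_mul (by positivity) (by positivity),
      Real.log_mul (by positivity) (by positivity), Real.log_inv, Real.log_pow, Real.log_pow,
      Real.log_div hr0.ne' ha0.ne'] at h3
    have h4 : (d : ℝ) * (Real.log a - Real.log r) ≤ r * N * (Real.log a - Real.log r) :=
      mul_le_mul_of_nonneg_right hi (by linarith)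
    simp only [E₂]
    linarith
  set T := toMeasurable μ Bad
  have hT : MeasurableSet T := measurableSet_toMeasurable _ _
  have hTr : μ.real T ≤ 2 * r := by
    rw [Measure.real, measure_toMeasurable]
    exact hBad
  have hle : ∀ x, -Real.log (q (f x)) ≤ E₂ + T.indicator (fun _ => E₁) x := fun x => by
    by_cases hx : x ∈ T
    · rw [indicator_of_mem hx]
      linarith [hall x]
    · rw [indicator_of_notMem hx, add_zero]
      exact hgood x fun hb => hx (subset_toMeasurable _ _ hb)
  have hiT : Integrable (T.indicator fun _ => E₁) μ := (integrable_const E₁).indicator hT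
  have hI := integral_mono hint ((integrable_const E₂).add hiT) hle
  simp only [Pi.add_apply] at hI
  rw [integral_add (integrable_const E₂) hiT, integral_indicator_const _ hT] at hI
  simp only [integral_const, probReal_univ, smul_eq_mul] at hI
  have h5 : μ.real T * E₁ ≤ 2 * r * E₁ := mul_le_mul_of_nonneg_right hTr hE₁
  have h6 : -Real.log (1 - r) ≤ N * -Real.log (1 - r) := le_mul_of_one_le_left (by linarith) hN
  have h7 : r * -Real.log r ≤ N * (r * -Real.log r) :=
    le_mul_of_one_le_left (mul_nonneg hr0.le (by linarith)) hN
  -- The coefficients 2 and 3 of `hammingRate` arise here: `E₂` contributes once per letter, the bad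
  -- words add `2 * r * E₁`, and the terms without a factor `N` are absorbed using `1 ≤ N`.
  have h8 : E₂ + 2 * r * E₁ ≤ Real.log k + N * hammingRate (Fintype.card α) r := by
    simp only [E₁, E₂, hammingRate, ← ha_def]
    linarith
  linarith

end Hamming

/-! ### From averaged distances to Hamming distances of names -/

section Lower

variable {G X : Type*} [Group G] [MulAction G X] [MeasurableSpace X]
  {μ : Measure X} [IsProbabilityMeasure μ] {ρ : X → X → ℝ}

/-- Terms with `g * f ∈ S` reappear in the unshifted sum. The others escape, and since `ρ` may be
unbounded the cap at 1 is what bounds them by their number. -/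
theorem sum_min_translate_le [DecidableEq G] (hρ : IsMeasurableSemimetric μ ρ) (S : Finset G)
    (g : G) (x y : X) :
    ∑ f ∈ S, min 1 (ρ (g • f • x) (g • f • y))
      ≤ ∑ f ∈ S, ρ (f • x) (f • y) + (escape g S).card := by
  rw [← Finset.sum_filter_add_sum_filter_not S (fun f => g * f ∈ S)]
  refine add_le_add ?_ ?_
  · refine (Finset.sum_le_sum fun f _ => min_le_right _ _).trans ?_
    have h1 : ∀ f, ρ (g • f • x) (g • f • y) = (fun k : G => ρ (k • x) (k • y)) (g * f) := fun f => by
      simp only [mul_smul]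
    simp only [h1]
    rw [← Finset.sum_image (f := fun k : G => ρ (k • x) (k • y)) (g := (g * ·))
      fun a _ b _ h => mul_left_cancel h]
    refine Finset.sum_le_sum_of_subset_of_nonneg (fun k hk => ?_) fun k _ _ => hρ.nonneg _ _
    obtain ⟨f, hf, rfl⟩ := Finset.mem_image.1 hk
    exact (Finset.mem_filter.1 hf).2
  · refine (Finset.sum_le_card_nsmul _ _ 1 fun f _ => min_le_left _ _).trans ?_
    rw [nsmul_eq_mul, mul_one, escape]

/-- Either some `v i` reaches 1, and `1 ≤ C` suffices, or the cap changes nothing. -/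
theorem one_le_mul_sum_min {ι : Type*} {S : Finset ι} {v : ι → ℝ} (hv : ∀ i, 0 ≤ v i) {C : ℝ}
    (hC : 1 ≤ C) (h : 1 ≤ C * ∑ i ∈ S, v i) : 1 ≤ C * ∑ i ∈ S, min 1 (v i) := by
  by_cases hi : ∃ i ∈ S, 1 ≤ v i
  · obtain ⟨i, hiS, hi⟩ := hi
    have h1 : min 1 (v i) ≤ ∑ i ∈ S, min 1 (v i) :=
      Finset.single_le_sum (f := fun i => min 1 (v i)) (fun j _ => le_min zero_le_one (hv j)) hiS
    rw [min_eq_left hi] at h1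
    nlinarith
  · push Not at hi
    rwa [Finset.sum_congr rfl fun i hiS => min_eq_right (hi i hiS).le]

variable [MeasurableConstSMul G X] [SMulInvariantMeasure G X μ]

/-- Regularity of each of the `m + 1` cells with tolerance `κ / (m + 1)`; the exceptional sets and
the finite sets of shifts are united. The summand 1 in the constant ensures `1 ≤ C` for capping. -/
theorem IsSuitableSemimetric.exists_lipschitz_partition [Countable G] [StandardBorelSpace X]
    {F : ℕ → Finset G} (hρ : IsSuitableSemimetric μ F ρ) {m : ℕ} {η : X → Fin (m + 1)}
    (hη : Measurable η) {κ : ℝ} (hκ : 0 < κ) :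
    ∃ B : Set X, MeasurableSet B ∧ μ.real B ≤ κ ∧ ∃ C : ℝ, 1 ≤ C ∧ ∃ S : Finset G,
      ∀ x ∉ B, ∀ y ∉ B, η x ≠ η y → 1 ≤ C * ∑ g ∈ S, min 1 (ρ (g • x) (g • y)) := by
  classical
  have hreg := fun i : Fin (m + 1) => (hρ.isRegular (hη (MeasurableSet.singleton i))).2
    (ENNReal.ofReal (κ / (m + 1))) (by simpa using by positivity)
  choose B hB C hC S hS using hreg
  set B' := ⋃ i, B i
  have hB' : μ B' ≤ ENNReal.ofReal κ := by
    refine (measure_iUnion_fintype_le _ _).trans ((Finset.sum_le_sum fun i _ => hB i).trans ?_)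
    rw [Finset.sum_const, Finset.card_univ, Fintype.card_fin, nsmul_eq_mul,
      ← ENNReal.ofReal_natCast, ← ENNReal.ofReal_mul (by positivity)]
    push_cast
    rw [mul_div_cancel₀ _ (by positivity)]
  refine ⟨toMeasurable μ B', measurableSet_toMeasurable _ _, ?_, 1 + ∑ i, C i,
    le_add_of_nonneg_right (Finset.sum_nonneg fun i _ => hC i), Finset.univ.biUnion S,
    fun x hx y hy hxy => ?_⟩
  · rw [Measure.real, measure_toMeasurable]
    exact ENNReal.toReal_le_of_le_ofReal hκ.le hB'
  · have hsub : ∀ z, z ∉ toMeasurable μ B' → z ∉ B (η x) := fun z hz hzB =>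
      hz (subset_toMeasurable _ _ (mem_iUnion_of_mem _ hzB))
    have h1 := hS (η x) x (hsub x hx) y (hsub y hy) rfl fun h => hxy h.symm
    have h0 := hρ.semimetric.nonneg
    have hC' : C (η x) ≤ 1 + ∑ i, C i := by
      have := Finset.single_le_sum (f := C) (fun i _ => hC i) (Finset.mem_univ (η x))
      linarith
    refine one_le_mul_sum_min (fun g => h0 _ _)
      (le_add_of_nonneg_right (Finset.sum_nonneg fun i _ => hC i)) (h1.trans ?_)
    refine mul_le_mul hC' ?_ (Finset.sum_nonneg fun g _ => h0 _ _) ((hC _).trans hC')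
    exact Finset.sum_le_sum_of_subset_of_nonneg
      (Finset.subset_biUnion_of_mem S (Finset.mem_univ (η x))) fun g _ _ => h0 _ _

/-- A disagreement at `f` occurs only if `f • x` or `f • y` lies in `B`, or if finitely many shifts
of `ρ` are large at `f`; the latter are moved back to `K` at the cost of escapes. -/
theorem card_refine_ne_le [DecidableEq G] (hρ : IsMeasurableSemimetric μ ρ) {m : ℕ}
    {η : X → Fin (m + 1)} {B : Set X} {C : ℝ} (hC : 0 ≤ C) {S : Finset G}
    (h : ∀ x ∉ B, ∀ y ∉ B, η x ≠ η y → 1 ≤ C * ∑ g ∈ S, min 1 (ρ (g • x) (g • y)))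
    (K : Finset G) (x y : X) :
    ((Finset.univ.filter fun s => refine K η x s ≠ refine K η y s).card : ℝ) ≤
      ∑ f ∈ K, B.indicator 1 (f • x) + ∑ f ∈ K, B.indicator 1 (f • y) +
      C * (S.card * ∑ f ∈ K, ρ (f • x) (f • y) + ∑ g ∈ S, ((escape g K).card : ℝ)) := by
  have h0 : ∀ f : G, 0 ≤ ∑ g ∈ S, min 1 (ρ (g • f • x) (g • f • y)) := fun f =>
    Finset.sum_nonneg fun g _ => le_min zero_le_one (hρ.nonneg _ _)
  have hi : ∀ z, (0 : ℝ) ≤ B.indicator 1 z := fun z => indicator_nonneg (fun _ _ => zero_le_one) z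
  have h1 : ∀ f : G, (if η (f • x) ≠ η (f • y) then (1 : ℝ) else 0) ≤
      B.indicator 1 (f • x) + B.indicator 1 (f • y)
        + C * ∑ g ∈ S, min 1 (ρ (g • f • x) (g • f • y)) := fun f => by
    have hC0 := mul_nonneg hC (h0 f)
    split_ifs with hne
    · by_cases hx : f • x ∈ B
      · rw [indicator_of_mem hx]
        have := hi (f • y)
        simp only [Pi.one_apply]
        linarith
      · by_cases hy : f • y ∈ B
        · rw [indicator_of_mem hy]
          have := hi (f • x)
          simp only [Pi.one_apply]
          linarith
        · have := h _ hx _ hy hne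
          linarith [hi (f • x), hi (f • y)]
    · linarith [hi (f • x), hi (f • y)]
  have h2 : ((Finset.univ.filter fun s => refine K η x s ≠ refine K η y s).card : ℝ)
      = ∑ f ∈ K, if η (f • x) ≠ η (f • y) then (1 : ℝ) else 0 := by
    rw [Finset.card_eq_sum_ones, Finset.sum_filter, ← Finset.sum_coe_sort K]
    push_cast
    rfl
  rw [h2]
  refine (Finset.sum_le_sum fun f _ => h1 f).trans ?_
  rw [Finset.sum_add_distrib, Finset.sum_add_distrib, ← Finset.mul_sum, Finset.sum_comm]
  gcongr
  refine (Finset.sum_le_sum fun g _ => sum_min_translate_le hρ K g x y).trans ?_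
  rw [Finset.sum_add_distrib, Finset.sum_const, nsmul_eq_mul]

/-- One point of each cell of the cover, off the bad set, serves as the centre of a Hamming ball of
relative radius `r`. The radius is split into four quarters: visits to `B` from either point, the
averaged distance, and the escapes. -/
theorem IsSuitableSemimetric.exists_log_card_ge [Countable G] [StandardBorelSpace X]
    {F : ℕ → Finset G} (hF : IsLeftFolner F) (hρ : IsSuitableSemimetric μ F ρ) {m : ℕ}
    {η : X → Fin (m + 1)} (hη : Measurable η) {c : ℝ} (hc : 0 < c)
    (hent : ∀ K : Finset G, c * K.card ≤ entropy μ (refine K η)) :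
    ∃ ε > 0, ∀ᶠ n in atTop, ∀ k, 1 ≤ k → HasEpsCover μ (average (F n) ρ) ε k →
      c / 2 * (F n).card ≤ Real.log k := by
  classical
  obtain ⟨r, hr0, hr1, hr⟩ := exists_hammingRate_le (m + 1) (half_pos hc)
  obtain ⟨B, hBm, hB, C, hC, S, hS⟩ :=
    hρ.exists_lipschitz_partition hη (show 0 < r * (r / 4) by positivity)
  have hC0 : 0 < C := one_pos.trans_le hC
  have hsc : 0 < C * (S.card + 1) := by positivity
  -- The bound `r` keeps the bad set, including `X₀`, below `2 * r`; the other bound makes the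
  -- distance term at most `r / 4`. The summand 1 allows for an empty `S`.
  set ε := min r (r / 4 / (C * (S.card + 1)))
  have hε : 0 < ε := lt_min hr0 (by positivity)
  have hεS : C * S.card * ε ≤ r / 4 := by
    have h1 : ε ≤ r / 4 / (C * (S.card + 1)) := min_le_right _ _
    rw [le_div_iff₀ hsc] at h1
    nlinarith
  have hlim : Tendsto (fun n => C * ∑ g ∈ S, ((escape g (F n)).card : ℝ) / (F n).card) atTop
      (𝓝 0) := by
    have := (tendsto_finsetSum S fun g _ => hF.tendsto_escape g).const_mul C
    simpa using this
  refine ⟨ε, hε, ?_⟩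
  filter_upwards [hlim.eventually (gt_mem_nhds (show 0 < r / 4 by positivity))] with n hn k hk hcov
  obtain ⟨X₀, A, -, -, hU, hX₀, hA⟩ := hcov
  have hpos : (0 : ℝ) < (F n).card := by exact_mod_cast (hF.1 n).card_pos
  have hne : Nonempty (F n) := (hF.1 n).to_subtype
  rw [← Finset.sum_div, mul_div_assoc', div_lt_iff₀ hpos] at hn
  set Bad := {x | r / 4 * (F n).card ≤ ∑ f ∈ F n, B.indicator (1 : X → ℝ) (f • x)}
  have hBad : μ.real (X₀ ∪ Bad) ≤ 2 * r := by
    have h1 := measure_average_ge_le (μ := μ) (u := B.indicator (1 : X → ℝ))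
      ((integrable_const (1 : ℝ)).indicator hBm)
      (fun x => indicator_nonneg (fun _ _ => zero_le_one) x) (hF.1 n)
      (show 0 < r / 4 by positivity)
    rw [integral_indicator_one hBm] at h1
    have h2 : μ.real B / (r / 4) ≤ r := (div_le_iff₀ (by positivity)).2 hB
    have h3 := measure_lt_ofReal_iff.1 hX₀
    have h4 : ε ≤ r := min_le_left _ _
    have h5 := measureReal_union_le (μ := μ) X₀ Bad
    linarith
  have hcenter : ∀ i, ∃ w : F n → Fin (m + 1), ∀ x ∈ A i \ Bad,
      ((Finset.univ.filter fun s => refine (F n) η x s ≠ w s).card : ℝ) ≤ r * (F n).card := by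
    intro i
    rcases (A i \ Bad).eq_empty_or_nonempty with he | ⟨y, hyA, hy⟩
    · exact ⟨fun _ => 0, fun x hx => absurd (he ▸ hx) (notMem_empty x)⟩
    · refine ⟨refine (F n) η y, fun x hx => ?_⟩
      refine (card_refine_ne_le hρ.semimetric hC0.le hS (F n) x y).trans ?_
      have hx' := not_le.1 (show ¬ r / 4 * (F n).card ≤ _ from hx.2)
      have hy' := not_le.1 (show ¬ r / 4 * (F n).card ≤ _ from hy)
      have hd : average (F n) ρ x y < ε := by
        have h1 : ENNReal.ofReal (average (F n) ρ x y) ≤ diam (average (F n) ρ) (A i) :=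
          le_iSup₂_of_le x hx.1 (le_iSup₂_of_le y hyA le_rfl)
        exact (ENNReal.ofReal_lt_ofReal_iff hε).1 (h1.trans_lt (hA i))
      rw [average, inv_mul_lt_iff₀ hpos] at hd
      have h2 : C * (S.card * ∑ f ∈ F n, ρ (f • x) (f • y)) ≤ r / 4 * (F n).card := by
        calc C * (S.card * ∑ f ∈ F n, ρ (f • x) (f • y))
            ≤ C * (S.card * ((F n).card * ε)) := by gcongr
          _ = C * S.card * ε * (F n).card := by ring
          _ ≤ _ := mul_le_mul_of_nonneg_right hεS hpos.le
      rw [mul_add]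
      linarith
  choose w hw using hcenter
  have hmain := entropy_le_of_hamming (measurable_refine (F n) hη) hr0 hr1 hBad hk w
    fun x hx => by
      rw [mem_union, not_or] at hx
      have hxU : x ∈ X₀ ∪ ⋃ i, A i := hU ▸ mem_univ x
      obtain ⟨i, hi⟩ := mem_iUnion.1 (hxU.resolve_left hx.1)
      exact ⟨i, by simpa using hw i x ⟨hi, hx.2⟩⟩
  rw [Fintype.card_coe, Fintype.card_fin] at hmain
  have h3 := hent (F n)
  have h4 : ((F n).card : ℝ) * hammingRate (m + 1) r ≤ (F n).card * (c / 2) :=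
    mul_le_mul_of_nonneg_left hr hpos.le
  linarith

/-- Otherwise there are sets `Y j` of diameter at most `2⁻ʲ` and co-measure below `2⁻ʲ`. By
Borel–Cantelli, all shifts of almost every point lie in `Y j` eventually. The generating property
makes such points coincide, but a single point is null. -/
theorem IsSuitableSemimetric.exists_not_small [Countable G] [NullSingletonClass μ]
    {F : ℕ → Finset G} (hρ : IsSuitableSemimetric μ F ρ) :
    ∃ ε > 0, ∀ Y : Set X, μ.real Yᶜ < ε → ¬ ∀ x ∈ Y, ∀ y ∈ Y, ρ x y < ε := by
  by_contra! hcon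
  choose Y hY hYρ using fun j : ℕ => hcon ((1 / 2 : ℝ) ^ j) (by positivity)
  have hsum : ∑' j, μ (Y j)ᶜ ≠ ∞ := by
    have h1 : ∀ j, μ (Y j)ᶜ ≤ ENNReal.ofReal ((1 / 2 : ℝ) ^ j) := fun j =>
      (measure_lt_ofReal_iff.2 (hY j)).le
    refine ne_top_of_le_ne_top ?_ (ENNReal.tsum_le_tsum h1)
    rw [← ENNReal.ofReal_tsum_of_nonneg (fun j => by positivity) summable_geometric_two]
    exact ENNReal.ofReal_ne_top
  have hBC : ∀ᵐ x ∂μ, ∀ᶠ j in atTop, x ∈ Y j :=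
    (ae_eventually_notMem hsum).mono fun x hx => hx.mono fun j hj => not_not.1 hj
  obtain ⟨X₀, hX₀, hgen⟩ := hρ.generating
  have hZ : ∀ᵐ x ∂μ, x ∈ X₀ ∧ ∀ g : G, ∀ᶠ j in atTop, g • x ∈ Y j :=
    Filter.Eventually.and hX₀ (ae_all_iff.2 fun g =>
      (measurePreserving_smul g μ).quasiMeasurePreserving.ae hBC)
  have hsub : {x | x ∈ X₀ ∧ ∀ g : G, ∀ᶠ j in atTop, g • x ∈ Y j}.Subsingleton := by
    intro x hx y hy
    by_contra hxy
    obtain ⟨n, g, -, hg⟩ := hgen x hx.1 y hy.1 hxy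
    have hlim : Tendsto (fun j : ℕ => (1 / 2 : ℝ) ^ j) atTop (𝓝 0) :=
      tendsto_pow_atTop_nhds_zero_of_lt_one (by norm_num) (by norm_num)
    obtain ⟨j, hj1, hj2, hj3⟩ :=
      ((hlim.eventually (gt_mem_nhds hg)).and ((hx.2 g).and (hy.2 g))).exists
    exact lt_asymm hj1 (hYρ j _ hj2 _ hj3)
  have h0 : μ {x | x ∈ X₀ ∧ ∀ g : G, ∀ᶠ j in atTop, g • x ∈ Y j} = 0 := hsub.measure_zero μ
  have h1 := measure_eq_zero_iff_ae_notMem.1 h0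
  obtain ⟨x, hx1, hx2⟩ := (hZ.and h1).exists
  exact hx2 hx1

theorem HasEpsCover.mono {ε ε' : ℝ} (h : ε ≤ ε') {k : ℕ} (hk : HasEpsCover μ ρ ε k) :
    HasEpsCover μ ρ ε' k := by
  obtain ⟨X₀, A, h1, h2, h3, h4, h5⟩ := hk
  have h' := ENNReal.ofReal_le_ofReal h
  exact ⟨X₀, A, h1, h2, h3, h4.trans_le h', fun i => (h5 i).trans_le h'⟩

theorem epsEntropy_antitone {ε ε' : ℝ} (h : ε ≤ ε') :
    epsEntropy μ ρ ε' ≤ epsEntropy μ ρ ε :=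
  le_iInf₂ fun k hk => le_iInf fun hc => iInf₂_le_of_le k hk (iInf_le _ (hc.mono h))

/-- One term of the average is at most `|S|` times the average, so a single cell small for the
average is, after translation, small for `ρ` itself. -/
theorem IsSuitableSemimetric.eventually_not_hasEpsCover_one [Countable G] [NullSingletonClass μ]
    {F : ℕ → Finset G} (hρ : IsSuitableSemimetric μ F ρ) {S : Finset G} (hS : S.Nonempty) :
    ∀ᶠ ε in 𝓝[>] (0 : ℝ), ¬ HasEpsCover μ (average S ρ) ε 1 := by
  obtain ⟨ε₀, hε₀, hsmall⟩ := hρ.exists_not_small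
  have hpos : (0 : ℝ) < S.card := by exact_mod_cast hS.card_pos
  have hone : (1 : ℝ) ≤ S.card := by exact_mod_cast hS.card_pos
  obtain ⟨g, hg⟩ := hS
  have hε₁ : 0 < ε₀ / S.card := by positivity
  filter_upwards [Ioc_mem_nhdsGT hε₁] with ε hε hcov
  obtain ⟨X₀, A, -, -, hU, hX₀, hA⟩ := hcov.mono hε.2
  have hle : ε₀ / S.card ≤ ε₀ := div_le_self hε₀.le hone
  refine hsmall ((g⁻¹ • ·) ⁻¹' A 0) ?_ fun x hx y hy => ?_
  · have h1 : ((g⁻¹ • ·) ⁻¹' A 0)ᶜ ⊆ (g⁻¹ • · : X → X) ⁻¹' X₀ := fun x hx => by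
      have hxU : g⁻¹ • x ∈ X₀ ∪ ⋃ i, A i := hU ▸ mem_univ _
      refine hxU.resolve_right fun h => ?_
      obtain ⟨i, hi⟩ := mem_iUnion.1 h
      rw [Subsingleton.elim i 0] at hi
      exact hx hi
    have h2 : μ ((g⁻¹ • · : X → X) ⁻¹' X₀) = μ X₀ := measure_preimage_smul μ g⁻¹ X₀
    refine measure_lt_ofReal_iff.1 (((measure_mono h1).trans h2.le).trans_lt (hX₀.trans_le ?_))
    exact ENNReal.ofReal_le_ofReal hle
  · have h1 : ENNReal.ofReal (average S ρ (g⁻¹ • x) (g⁻¹ • y)) ≤ diam (average S ρ) (A 0) :=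
      le_iSup₂_of_le (g⁻¹ • x) hx (le_iSup₂_of_le (g⁻¹ • y) hy le_rfl)
    have h2 := (ENNReal.ofReal_lt_ofReal_iff hε₁).1 (h1.trans_lt (hA 0))
    rw [average, inv_mul_lt_iff₀ hpos, mul_div_cancel₀ _ hpos.ne'] at h2
    have h3 := Finset.single_le_sum (f := fun k : G => ρ (k • g⁻¹ • x) (k • g⁻¹ • y))
      (fun k _ => hρ.semimetric.nonneg _ _) hg
    rw [smul_inv_smul, smul_inv_smul] at h3
    exact h3.trans_lt h2

/-- In positive entropy, the scaling function grows at least linearly in the size of the Følner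
sets. -/
theorem IsSuitableSemimetric.exists_card_le_epsEntropy [Countable G] [StandardBorelSpace X]
    [NullSingletonClass μ] {F : ℕ → Finset G} (hF : IsLeftFolner F)
    (hρ : IsSuitableSemimetric μ F ρ) (hpos : 0 < measureEntropy μ F) :
    ∃ ε > 0, ∃ C : ℝ≥0, 0 < C ∧ ∀ n, ((F n).card : ℝ≥0∞) ≤ C * scalingFunction μ F ρ n ε := by
  obtain ⟨m, η, c, hη, hc, hent⟩ := exists_finite_partition_of_measureEntropy_pos hF hpos
  obtain ⟨ε₁, hε₁, hlarge⟩ := hρ.exists_log_card_ge hF hη hc hent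
  obtain ⟨N, hN⟩ := eventually_atTop.1 hlarge
  have hsmall : ∀ᶠ ε in 𝓝[>] (0 : ℝ), ∀ n ∈ Finset.range N,
      ¬ HasEpsCover μ (average (F n) ρ) ε 1 :=
    (Finset.eventually_all _).2 fun n _ => hρ.eventually_not_hasEpsCover_one (hF.1 n)
  obtain ⟨ε, hε, hεmem⟩ := (hsmall.and (Ioc_mem_nhdsGT hε₁)).exists
  set C : ℝ≥0 := (2 / c).toNNReal + ∑ n ∈ Finset.range N, ((F n).card : ℝ≥0)
  have hc2 : 0 < (2 / c).toNNReal := Real.toNNReal_pos.2 (by positivity)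
  refine ⟨ε, hεmem.1, C, add_pos_of_pos_of_nonneg hc2 (by positivity), fun n => ?_⟩
  by_cases hn : n < N
  · have h1 : 1 ≤ scalingFunction μ F ρ n ε := by
      refine le_iInf₂ fun k hk => le_iInf fun hcov => ?_
      have hk2 : 2 ≤ k := by
        by_contra h
        obtain rfl : k = 1 := by omega
        exact hε n (Finset.mem_range.2 hn) hcov
      rw [← ENNReal.ofReal_one]
      refine ENNReal.ofReal_le_ofReal ?_
      rw [Real.le_logb_iff_rpow_le one_lt_two (by positivity), Real.rpow_one]
      exact_mod_cast hk2
    have h2 : ((F n).card : ℝ≥0) ≤ C := le_add_of_nonneg_of_le zero_le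
      (Finset.single_le_sum (f := fun n => ((F n).card : ℝ≥0)) (fun _ _ => zero_le)
        (Finset.mem_range.2 hn))
    calc ((F n).card : ℝ≥0∞) = ((F n).card : ℝ≥0) * 1 := by simp
      _ ≤ C * scalingFunction μ F ρ n ε := by gcongr
  · have h1 : ENNReal.ofReal (c / 2 * (F n).card) ≤ scalingFunction μ F ρ n ε := by
      refine le_trans ?_ (epsEntropy_antitone hεmem.2)
      refine le_iInf₂ fun k hk => le_iInf fun hcov => ENNReal.ofReal_le_ofReal ?_
      refine (hN n (not_lt.1 hn) k hk hcov).trans ?_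
      -- Passing from the natural to the binary logarithm only increases the bound.
      have hlog2 : Real.log 2 ≤ 1 := by linarith [Real.log_two_lt_d9]
      exact le_div_self (Real.log_nonneg (by exact_mod_cast hk)) (Real.log_pos one_lt_two) hlog2
    calc ((F n).card : ℝ≥0∞) = ENNReal.ofReal (2 / c) * ENNReal.ofReal (c / 2 * (F n).card) := by
          rw [← ENNReal.ofReal_mul (by positivity), ← mul_assoc]
          have : 2 / c * (c / 2) = 1 := by field_simp
          rw [this, one_mul, ENNReal.ofReal_natCast]
      _ ≤ C * scalingFunction μ F ρ n ε := by
          gcongr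
          exact ENNReal.coe_le_coe.2 le_self_add

/-- In zero entropy, the entropy rates of all finite partitions tend to zero. -/
theorem tendsto_entropy_div_card_of_measureEntropy_eq_zero {F : ℕ → Finset G}
    (h : measureEntropy μ F = 0) {m : ℕ} {η : X → Fin (m + 1)}
    (hη : Measurable η) :
    Tendsto (fun n => entropy μ (refine (F n) η) / (F n).card) atTop (𝓝 0) := by
  set ξ : X → ℕ := fun x => η x
  have hξ : Measurable ξ := Measurable.of_discrete.comp hη
  have hinfo : info μ ξ = info μ η := info_congr fun x y => by simp [ξ, Fin.ext_iff]
  have hinfo' : ∀ S : Finset G, info μ (refine S ξ) = info μ (refine S η) := fun S =>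
    info_congr fun x y => by simp [ξ, refine, funext_iff, Fin.ext_iff]
  have hi : Integrable (info μ ξ) μ := hinfo ▸ integrable_info hη
  have hi' : ∀ S : Finset G, Integrable (info μ (refine S ξ)) μ := fun S =>
    hinfo' S ▸ integrable_info (measurable_refine S hη)
  simp only [measureEntropy, ENNReal.iSup_eq_zero] at h
  have h0 := h ξ hξ (by
    rw [shannonEntropy_eq hi]
    exact ENNReal.ofReal_lt_top)
  have hlim : Tendsto (fun n => shannonEntropy μ (refine (F n) ξ) / ((F n).card : ℝ≥0∞)) atTop
      (𝓝 0) := tendsto_of_le_liminf_of_limsup_le zero_le h0.le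
  have := (ENNReal.tendsto_toReal ENNReal.zero_ne_top).comp hlim
  refine this.congr fun n => ?_
  rw [Function.comp_apply, shannonEntropy_eq (hi' _), ENNReal.toReal_div,
    ENNReal.toReal_ofReal (entropy_nonneg _), ENNReal.toReal_natCast, entropy, hinfo', entropy]

theorem AsympEq.of_le {φ ψ : ℕ → ℝ≥0∞} {C C' : ℝ≥0} (hC : 0 < C) (hC' : 0 < C')
    (h : ∀ n, φ n ≤ C * ψ n) (h' : ∀ n, ψ n ≤ C' * φ n) : AsympEq φ ψ := by
  refine ⟨C⁻¹, C', inv_pos.2 hC, hC', fun n => ⟨?_, h' n⟩⟩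
  calc (C⁻¹ : ℝ≥0) * φ n ≤ (C⁻¹ : ℝ≥0) * (C * ψ n) := by
        gcongr
        exact h n
    _ = ψ n := by
        rw [← mul_assoc, ← ENNReal.coe_mul, inv_mul_cancel₀ hC.ne', ENNReal.coe_one, one_mul]

end Lower

end ScalingEntropy

/-! ### Linear growth in positive entropy, sublinear growth in zero entropy -/

theorem mainTheorem3 {G X : Type*} [Group G] [Countable G]
    [MeasurableSpace X] [StandardBorelSpace X]
    [MulAction G X] [MeasurableConstSMul G X]
    (μ : Measure X) [IsProbabilityMeasure μ] [NullSingletonClass μ] [SMulInvariantMeasure G X μ]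
    (F : ℕ → Finset G) (hF : ScalingEntropy.IsLeftFolner F) :
    (0 < ScalingEntropy.measureEntropy μ F →
      ScalingEntropy.IsStable μ F ∧
      ∀ Φ ∈ ScalingEntropy.scalingEntropy μ F,
        (∀ n, AntitoneOn (Φ n) (Ioi 0)) →
          ∃ ε₀ > 0, ∀ ε, 0 < ε → ε < ε₀ →
            ScalingEntropy.AsympEq (fun n => Φ n ε) (fun n => ((F n).card : ℝ≥0∞))) ∧
    (ScalingEntropy.measureEntropy μ F = 0 →
      ∀ Φ ∈ ScalingEntropy.scalingEntropy μ F, ∀ ε > 0,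
        Tendsto (fun n => Φ n ε / ((F n).card : ℝ≥0∞)) atTop (𝓝 0)) := by
  refine ⟨fun hpos => ⟨⟨fun n => (F n).card, fun ρ hρ => ?_⟩, ?_⟩, ?_⟩
  · obtain ⟨ε₀, hε₀, C, hC, hlow⟩ := hρ.exists_card_le_epsEntropy hF hpos
    refine ⟨ε₀, hε₀, fun ε hε hεε₀ => ?_⟩
    obtain ⟨C', hC', hup⟩ := ScalingEntropy.exists_epsEntropy_le_card (G := G)
      hρ.semimetric hρ.admissible hρ.summable hε
    refine ScalingEntropy.AsympEq.of_le hC' hC (fun n => by simpa using! hup (F n) (hF.1 n))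
      fun n => ?_
    simp only [ENNReal.coe_natCast]
    refine (hlow n).trans ?_
    gcongr
    exact ScalingEntropy.epsEntropy_antitone hεε₀.le
  · rintro Φ ⟨ρ, hρ, hle, hge⟩ hanti
    obtain ⟨ε₁, hε₁, C, hC, hlow⟩ := hρ.exists_card_le_epsEntropy hF hpos
    -- Equivalence gives a lower bound for `Φ` only at this one `ε₀`; monotonicity in `ε` carries it
    -- to all smaller values.
    obtain ⟨ε₀, hε₀, C₁, hC₁, h₁⟩ := hge ε₁ hε₁
    refine ⟨ε₀, hε₀, fun ε hε hεε₀ => ?_⟩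
    obtain ⟨δ, hδ, C₂, hC₂, h₂⟩ := hle ε hε
    obtain ⟨C', hC', hup⟩ := ScalingEntropy.exists_epsEntropy_le_card (G := G)
      hρ.semimetric hρ.admissible hρ.summable hδ
    refine ScalingEntropy.AsympEq.of_le (mul_pos hC₂ hC') (mul_pos hC hC₁) (fun n => ?_)
      fun n => ?_
    · rw [ENNReal.coe_mul, mul_assoc]
      refine (h₂ n).trans ?_
      gcongr
      exact hup (F n) (hF.1 n)
    · rw [ENNReal.coe_mul, mul_assoc]
      refine (hlow n).trans ?_
      gcongr
      refine (h₁ n).trans ?_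
      gcongr
      exact hanti n hε hε₀ hεε₀.le
  · rintro hzero Φ ⟨ρ, hρ, hle, -⟩ ε hε
    obtain ⟨δ, hδ, C, hC, h⟩ := hle ε hε
    have hlim := ScalingEntropy.tendsto_epsEntropy_div_card hρ.semimetric hρ.admissible
      hρ.summable hF.1 (fun m η hη =>
        ScalingEntropy.tendsto_entropy_div_card_of_measureEntropy_eq_zero hzero hη) hδ
    have hlim' := ENNReal.Tendsto.const_mul (a := (C : ℝ≥0∞)) hlim (Or.inr ENNReal.coe_ne_top)
    rw [mul_zero] at hlim'
    refine tendsto_of_tendsto_of_tendsto_of_le_of_le tendsto_const_nhds hlim'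
      (fun n => zero_le) fun n => ?_
    simp only
    rw [← mul_div_assoc]
    gcongr
    exact h n
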